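/- Conventions. Let $A$ be a finite alphabet with the discrete topology. A $\mathbb Z^2$-subshift is a closed subset $X\subset A^{\mathbb Z^2}$ invariant under all translations $(T^u x)(v)=x(u+v)$, $u\in\mathbb Z^2$. For $S,T\subset\mathbb R^2$, $S$ *$X$-codes* $T$ if any $x,x'\in X$ that agree on $S\cap\mathbb Z^2$ also agree on $T\cap\mathbb Z^2$. Rays are considered up to translation, and two rays (or a ray and an oriented segment) are *positively parallel* if they have the same direction, with orientation. A ray $\ell$ with direction $w\neq 0$ is *nonexpansive* for $X$ if the closed half plane $H$ bounded by the line $\mathbb R w$ and lying to the left of $w$ (so that $w$ gives the boundary orientation of $H$) does not $X$-code $\mathbb R^2$. The ray $\ell$ has *rational slope* if it has the direction of a nonzero vector of $\mathbb Z^2$. It is *closing* if it is nonexpansive, has rational slope, and, with $H$ as above, $L=\mathbb R w$, and $L_0$ the closest line to $H$ among the lines $z+L$ ($z\in\mathbb Z^2$) in the complement of $H$, there is $N>0$ such that for every block $\mathcal B\subset L_0\cap\mathbb Z^2$ (the set of lattice points of a segment of $L_0$) with at least $N$ points, $H\cup\mathcal B$ $X$-codes $H\cup L_0$. A $\mathbb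 Z^2$-subshift $Y$ over a finite alphabet is a *recoding* of $X$ if there are a finite set $F\subset\mathbb Z^2$ and a homeomorphism $\Psi:X\to Y$ commuting with all translations such that, for all $p\in\mathbb Z^2$ and $x,x'\in X$, $\Psi(x)(p)=\Psi(x')(p)$ if and only if $x$ and $x'$ agree on $F+p$. A *convex integer polygon* is the convex hull $P$ of a finite set of points of $\mathbb Z^2$ containing at least two points; the degenerate case of a segment is allowed. Its edges carry the boundary orientation ($P$ lies to the left of each oriented edge); a segment has two oriented edges, with opposite directions. An infinite $\mathbb Z^2$-subshift $Y$ is *polygonal* with *coding polygon* $P$ if for every vertex $v$ of $P$ the set $P\setminus\{v\}$ $Y$-codes $\{v\}$. Theorem. Let $X$ be a $\mathbb Z^2$-subshift whose set of nonexpansive rays is finite and nonempty, and suppose that each nonexpansive ray has rational slope and is closing. Then there are a recoding $Y$ of $X$ and a convex integer polygon $P$ (possibly degenerate) such that $Y$ is polygonal with coding polygon $P$, every oriented edge of $P$ is positively parallel to a nonexpansive ray of $X$, and every nonexpansive ray of $X$ is positively parallel to an oriented edge of $P$. -/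

import Mathlib

universe u v

namespace PolygonalShift

open SymbolicDynamics.FullShift

noncomputable section

/-- The inclusion of the integer lattice `ℤ²` in the plane `ℝ²`. -/
def toPlane (z : ℤ × ℤ) : ℝ × ℝ := ((z.1 : ℝ), (z.2 : ℝ))

/-- The determinant of the pair `(p, q)`; it is positive when `q` points to the left of `p`. -/
def cross (p q : ℝ × ℝ) : ℝ := p.1 * q.2 - p.2 * q.1

/-- The set `S` `X`-codes the set `T`: two elements of `X` which agree on the lattice points of `S`
also agree on the lattice points of `T`. -/
def Codes {A : Type u} [TopologicalSpace A] (X : Subshift A (ℤ × ℤ)) (S T : Set (ℝ × ℝ)) : Prop :=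
  ∀ x ∈ X.carrier, ∀ x' ∈ X.carrier,
    (∀ z : ℤ × ℤ, toPlane z ∈ S → x z = x' z) → ∀ z : ℤ × ℤ, toPlane z ∈ T → x z = x' z

/-- The closed half plane bounded by the line `ℝ w` whose boundary orientation is the direction
of `w`, that is, the half plane lying to the left of `w`. -/
def halfPlane (w : ℝ × ℝ) : Set (ℝ × ℝ) := {p | 0 ≤ cross w p}

/-- A ray is taken up to translation, as an element of `Module.Ray ℝ (ℝ × ℝ)`; thus two rays are
positively parallel exactly when they are equal here. A ray is nonexpansive when the closed half
plane on its left does not code the plane. (A half plane codes the plane if and only if each of its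
translates does, open or closed, so the half plane bounded by a line through `0` suffices.) -/
def IsNonexpansive {A : Type u} [TopologicalSpace A] (X : Subshift A (ℤ × ℤ))
    (ρ : Module.Ray ℝ (ℝ × ℝ)) : Prop :=
  ∃ (w : ℝ × ℝ) (hw : w ≠ 0), rayOfNeZero ℝ w hw = ρ ∧ ¬ Codes X (halfPlane w) Set.univ

/-- A ray has rational slope (possibly infinite): it contains a nonzero lattice vector. -/
def IsRational (ρ : Module.Ray ℝ (ℝ × ℝ)) : Prop :=
  ∃ (z : ℤ × ℤ) (hz : toPlane z ≠ 0), rayOfNeZero ℝ (toPlane z) hz = ρ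

/-- The line through the lattice point `z` with direction `w`. -/
def latticeLine (w : ℝ × ℝ) (z : ℤ × ℤ) : Set (ℝ × ℝ) := {p | ∃ t : ℝ, p = toPlane z + t • w}

/-- Among the lines `z' + ℝ w`, `z' ∈ ℤ²`, in the complement of `halfPlane w`, the one through `z`
is the closest to `halfPlane w`. (The distance from `ℝ w` to a point `p` of the complement is
`-cross w p / ‖w‖`.) -/
def IsNearest (w : ℝ × ℝ) (z : ℤ × ℤ) : Prop :=
  toPlane z ∉ halfPlane w ∧
    ∀ z' : ℤ × ℤ, toPlane z' ∉ halfPlane w → cross w (toPlane z') ≤ cross w (toPlane z)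

/-- A ray `ρ` is closing: it is rational and nonexpansive and, with `H` the closed half plane on its
left and `L₀` the closest parallel lattice line outside `H`, there is `N > 0` such that for every
block `I ∩ ℤ²` (`I` a segment of `L₀`) with at least `N` points, `H ∪ I` codes `H ∪ L₀`. -/
def IsClosing {A : Type u} [TopologicalSpace A] (X : Subshift A (ℤ × ℤ))
    (ρ : Module.Ray ℝ (ℝ × ℝ)) : Prop :=
  IsRational ρ ∧ IsNonexpansive X ρ ∧
    ∃ (w : ℝ × ℝ) (hw : w ≠ 0), rayOfNeZero ℝ w hw = ρ ∧
      ∃ z : ℤ × ℤ, IsNearest w z ∧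
        ∃ N : ℕ, 0 < N ∧ ∀ a ∈ latticeLine w z, ∀ b ∈ latticeLine w z,
          N ≤ {y : ℤ × ℤ | toPlane y ∈ segment ℝ a b}.ncard →
            Codes X (halfPlane w ∪ segment ℝ a b) (halfPlane w ∪ latticeLine w z)

/-- `Y` is a recoding of `X`: for some finite `F ⊆ ℤ²` there is an isomorphism `Ψ` of shifts
(a homeomorphism commuting with all translations) such that the color of `Ψ x` at `p` and
the restriction of `x` to `F + p` determine each other. -/
def IsRecoding {A : Type u} [TopologicalSpace A] {B : Type v} [TopologicalSpace B]
    (X : Subshift A (ℤ × ℤ)) (Y : Subshift B (ℤ × ℤ)) : Prop :=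
  ∃ (F : Finset (ℤ × ℤ)) (Ψ : X.carrier ≃ₜ Y.carrier),
    (∀ (g : ℤ × ℤ) (x : X.carrier),
      (Ψ ⟨shift g x.1, X.mapsTo g x.2⟩).1 = shift g (Ψ x).1) ∧
    ∀ (p : ℤ × ℤ) (x x' : X.carrier),
      (Ψ x).1 p = (Ψ x').1 p ↔ ∀ f ∈ F, x.1 (f + p) = x'.1 (f + p)

/-- Convex integer polygons: convex hulls of finite sets of lattice points, not reduced to a point
or empty. A degenerate polygon, i.e. a segment, is allowed. The vertices of `P` are its extreme
points; they are lattice points. -/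
def IsIntegerPolygon (P : Set (ℝ × ℝ)) : Prop :=
  P.Nontrivial ∧ ∃ V : Finset (ℤ × ℤ), P = convexHull ℝ (toPlane '' (V : Set (ℤ × ℤ)))

/-- The segment from the vertex `a` to the vertex `b` is an oriented edge of the convex polygon `P`
for the orientation of the boundary, i.e. `P` lies to its left. A degenerate
polygon (a segment) has two oriented edges, with opposite directions. -/
def IsOrientedEdge (P : Set (ℝ × ℝ)) (a b : ℝ × ℝ) : Prop :=
  a ∈ P.extremePoints ℝ ∧ b ∈ P.extremePoints ℝ ∧ a ≠ b ∧ ∀ p ∈ P, 0 ≤ cross (b - a) (p - a)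

/-- The oriented segment from `a` to `b` is positively parallel to the ray `ρ`. -/
def PositivelyParallel (a b : ℝ × ℝ) (ρ : Module.Ray ℝ (ℝ × ℝ)) : Prop :=
  ∃ h : b - a ≠ 0, rayOfNeZero ℝ (b - a) h = ρ

/-- The infinite shift `X` is polygonal with coding polygon `P`: for every vertex `e` of `P`,
`P \ {e}` codes `e`. -/
def IsPolygonal {A : Type u} [TopologicalSpace A] (X : Subshift A (ℤ × ℤ))
    (P : Set (ℝ × ℝ)) : Prop :=
  X.carrier.Infinite ∧ IsIntegerPolygon P ∧ ∀ e ∈ P.extremePoints ℝ, Codes X (P \ {e}) {e}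

end

end PolygonalShift

/-! ### Euclidean geometry of the plane and the lattice -/

namespace PolygonalShift

open SymbolicDynamics.FullShift Filter Topology

/-! Recode `X` by its patterns on the translates of a large finite set `F`, and let `P` be a polygon
whose edges have the nonexpansive directions. If `e` is a vertex of `P`, the patterns at the other
vertices `v` reveal, inside the pattern at `e`, the positions `q ∈ F` with `q + (e - v) ∈ F`. So two
things are needed: an `F` on which agreement at these positions forces agreement everywhere, and the
existence of `P`.

For `F` take `truncatedDisc Ω n`: a disc of radius `n`, from which each unit nonexpansive direction
`ω` cuts the cap beyond the chord parallel to `ω` at distance `n - 1` from the centre. The chords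
have length of order `√n`, so every flat side becomes arbitrarily long, and far from the centre the
discs look like half planes. If coding fails for arbitrarily large `n`
(`eventually_truncatedDisc_codes`), translate to the origin a disagreement `q` minimal for `gauge`,
whose sublevel sets are the truncated discs, and pass to a limit. The limit pair disagrees at `0`
but agrees on an open half plane, so its boundary direction `ω` is nonexpansive. Some `e ∈ E` points
inward or along `ω`, yet carries `q` out of the disc. Inward is impossible; along `ω`, the point `q`
must be far out on the flat side, with ever longer stretches of agreement behind it, and closing
(`ClosesAt`) gives a contradiction.

`P` exists as soon as some positive integer multiples of the direction vectors have sum zero: sort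
them by argument and take partial sums as vertices. Such multiples exist (`exists_pos_relation`)
unless the vectors lie on one side of a rational line without all being parallel to it. In that
case, with `a` along the line, the coding theorem for `E = {-a}` makes the pattern on one disc
determine a half-orbit under `a`; by pigeonhole a multiple of `a` is a period, and every direction
transverse to a period is expansive (`cross_eq_zero_of_one_sided`). -/

/-- The Euclidean scalar product of the plane. -/
def dot (p q : ℝ × ℝ) : ℝ := p.1 * q.1 + p.2 * q.2

/-- The Euclidean norm of the plane. -/
noncomputable def nrm (p : ℝ × ℝ) : ℝ := √(dot p p)

lemma dot_self_nonneg (p : ℝ × ℝ) : 0 ≤ dot p p := by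
  unfold dot; nlinarith [sq_nonneg p.1, sq_nonneg p.2]

lemma nrm_nonneg (p : ℝ × ℝ) : 0 ≤ nrm p := Real.sqrt_nonneg _

lemma nrm_sq (p : ℝ × ℝ) : nrm p ^ 2 = dot p p := Real.sq_sqrt (dot_self_nonneg p)

lemma dot_self_pos {p : ℝ × ℝ} (hp : p ≠ 0) : 0 < dot p p := by
  refine lt_of_le_of_ne (dot_self_nonneg p) fun h => hp ?_
  unfold dot at h
  ext <;> simp <;> nlinarith [sq_nonneg p.1, sq_nonneg p.2]

lemma nrm_pos {p : ℝ × ℝ} (hp : p ≠ 0) : 0 < nrm p := Real.sqrt_pos.2 (dot_self_pos hp)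

lemma nrm_le_iff {p : ℝ × ℝ} {r : ℝ} (hr : 0 ≤ r) : nrm p ≤ r ↔ dot p p ≤ r ^ 2 :=
  Real.sqrt_le_left hr

lemma nrm_lt_nrm_iff {p q : ℝ × ℝ} : nrm p < nrm q ↔ dot p p < dot q q :=
  Real.sqrt_lt_sqrt_iff (dot_self_nonneg p)

lemma cross_sq_add_dot_sq (p q : ℝ × ℝ) : cross p q ^ 2 + dot p q ^ 2 = dot p p * dot q q := by
  unfold cross dot; ring

lemma abs_cross_le (p q : ℝ × ℝ) : |cross p q| ≤ nrm p * nrm q := by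
  apply abs_le_of_sq_le_sq _ (mul_nonneg (nrm_nonneg _) (nrm_nonneg _))
  rw [mul_pow, nrm_sq, nrm_sq, ← cross_sq_add_dot_sq]
  nlinarith [sq_nonneg (dot p q)]

lemma abs_dot_le (p q : ℝ × ℝ) : |dot p q| ≤ nrm p * nrm q := by
  apply abs_le_of_sq_le_sq _ (mul_nonneg (nrm_nonneg _) (nrm_nonneg _))
  rw [mul_pow, nrm_sq, nrm_sq, ← cross_sq_add_dot_sq]
  nlinarith [sq_nonneg (cross p q)]

lemma nrm_add_le (p q : ℝ × ℝ) : nrm (p + q) ≤ nrm p + nrm q := by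
  rw [nrm_le_iff (add_nonneg (nrm_nonneg _) (nrm_nonneg _))]
  have h := (abs_le.1 (abs_dot_le p q)).2
  have h1 := nrm_sq p
  have h2 := nrm_sq q
  have : dot (p + q) (p + q) = dot p p + 2 * dot p q + dot q q := by
    simp only [dot, Prod.fst_add, Prod.snd_add]; ring
  nlinarith

lemma dot_add_self (p q : ℝ × ℝ) :
    dot (p + q) (p + q) = dot p p + 2 * dot q p + dot q q := by
  simp only [dot, Prod.fst_add, Prod.snd_add]; ring

lemma cross_add_right (p q q' : ℝ × ℝ) : cross p (q + q') = cross p q + cross p q' := by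
  simp only [cross, Prod.fst_add, Prod.snd_add]; ring

lemma dot_add_right (p q q' : ℝ × ℝ) : dot p (q + q') = dot p q + dot p q' := by
  simp only [dot, Prod.fst_add, Prod.snd_add]; ring

lemma toPlane_add (p q : ℤ × ℤ) : toPlane (p + q) = toPlane p + toPlane q := by
  simp [toPlane]

lemma toPlane_sub (p q : ℤ × ℤ) : toPlane (p - q) = toPlane p - toPlane q := by
  simp [toPlane]

lemma toPlane_neg (p : ℤ × ℤ) : toPlane (-p) = -toPlane p := by
  simp [toPlane]

lemma toPlane_zero : toPlane 0 = 0 := by simp [toPlane]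

lemma toPlane_injective : Function.Injective toPlane := by
  rintro ⟨a, b⟩ ⟨c, d⟩ h
  simpa [toPlane] using h

lemma toPlane_ne_zero {z : ℤ × ℤ} (hz : z ≠ 0) : toPlane z ≠ 0 := fun h =>
  hz (toPlane_injective (h.trans toPlane_zero.symm))

/-! ### Truncated discs -/

/-- The lattice points of a disc of radius `r` truncated along the directions in `Ω`. -/
def truncatedDisc (Ω : Finset (ℝ × ℝ)) (r : ℝ) : Set (ℤ × ℤ) :=
  {p | nrm (toPlane p) ≤ r ∧ ∀ ω ∈ Ω, 1 - cross ω (toPlane p) ≤ r}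

lemma abs_fst_le_nrm (p : ℝ × ℝ) : |p.1| ≤ nrm p := by
  apply abs_le_of_sq_le_sq _ (nrm_nonneg _)
  rw [nrm_sq, dot]; nlinarith [sq_nonneg p.2]

lemma abs_snd_le_nrm (p : ℝ × ℝ) : |p.2| ≤ nrm p := by
  apply abs_le_of_sq_le_sq _ (nrm_nonneg _)
  rw [nrm_sq, dot]; nlinarith [sq_nonneg p.1]

lemma finite_nrm_le (r : ℝ) : {p : ℤ × ℤ | nrm (toPlane p) ≤ r}.Finite := by
  refine ((Set.finite_Icc (-⌈r⌉) ⌈r⌉).prod (Set.finite_Icc (-⌈r⌉) ⌈r⌉)).subset fun p hp => ?_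
  have key : ∀ m : ℤ, |(m : ℝ)| ≤ r → m ∈ Set.Icc (-⌈r⌉) ⌈r⌉ := fun m hm => by
    have h1 := (abs_le.1 hm)
    have h2 := Int.le_ceil r
    constructor
    · have : (-⌈r⌉ : ℝ) ≤ m := by linarith [h1.1]
      exact_mod_cast this
    · have : (m : ℝ) ≤ ⌈r⌉ := by linarith [h1.2]
      exact_mod_cast this
  exact ⟨key _ ((abs_fst_le_nrm (toPlane p)).trans hp),
    key _ ((abs_snd_le_nrm (toPlane p)).trans hp)⟩

lemma truncatedDisc_finite (Ω : Finset (ℝ × ℝ)) (r : ℝ) : (truncatedDisc Ω r).Finite :=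
  (finite_nrm_le r).subset fun _ hp => hp.1

/-- The function whose sublevel sets are the truncated discs. -/
noncomputable def gauge (Ω : Finset (ℝ × ℝ)) (hΩ : Ω.Nonempty) (p : ℤ × ℤ) : ℝ :=
  max (nrm (toPlane p)) (Ω.sup' hΩ fun ω => 1 - cross ω (toPlane p))

lemma gauge_le_iff {Ω : Finset (ℝ × ℝ)} (hΩ : Ω.Nonempty) {p : ℤ × ℤ} {r : ℝ} :
    gauge Ω hΩ p ≤ r ↔ p ∈ truncatedDisc Ω r := by
  simp [gauge, truncatedDisc]

lemma gauge_lt_iff {Ω : Finset (ℝ × ℝ)} (hΩ : Ω.Nonempty) {p : ℤ × ℤ} {r : ℝ} :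
    gauge Ω hΩ p < r ↔ nrm (toPlane p) < r ∧ ∀ ω ∈ Ω, 1 - cross ω (toPlane p) < r := by
  simp [gauge]

lemma zero_mem_truncatedDisc (Ω : Finset (ℝ × ℝ)) {r : ℝ} (hr : 1 ≤ r) :
    (0 : ℤ × ℤ) ∈ truncatedDisc Ω r := by
  refine ⟨?_, fun ω _ => ?_⟩
  · simp [toPlane_zero, nrm, dot]; linarith
  · simp [toPlane_zero, cross]; linarith

/-! ### Points going to infinity in a limit direction -/

section Direction

variable {l : Filter ℕ} {q : ℕ → ℤ × ℤ} {d : ℝ × ℝ}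

lemma tendsto_dot_div (hq : Tendsto (fun k => (nrm (toPlane (q k)))⁻¹ • toPlane (q k)) l (𝓝 d))
    (a : ℝ × ℝ) : Tendsto (fun k => dot a (toPlane (q k)) / nrm (toPlane (q k))) l
      (𝓝 (dot a d)) := by
  have hc : Continuous (dot a) := by unfold dot; fun_prop
  refine ((hc.tendsto d).comp hq).congr fun k => ?_
  simp only [Function.comp, dot, Prod.smul_fst, Prod.smul_snd, smul_eq_mul]
  ring

lemma tendsto_cross_div (hq : Tendsto (fun k => (nrm (toPlane (q k)))⁻¹ • toPlane (q k)) l (𝓝 d))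
    (a : ℝ × ℝ) : Tendsto (fun k => cross a (toPlane (q k)) / nrm (toPlane (q k))) l
      (𝓝 (cross a d)) := by
  have hc : Continuous (cross a) := by unfold cross; fun_prop
  refine ((hc.tendsto d).comp hq).congr fun k => ?_
  simp only [Function.comp, cross, Prod.smul_fst, Prod.smul_snd, smul_eq_mul]
  ring

/-- Translating far away points into the half plane on the inner side decreases the norm. -/
lemma eventually_nrm_add_lt (hR : Tendsto (fun k => nrm (toPlane (q k))) l atTop)
    (hq : Tendsto (fun k => (nrm (toPlane (q k)))⁻¹ • toPlane (q k)) l (𝓝 d)) {s : ℝ × ℝ}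
    (hs : dot s d < 0) : ∀ᶠ k in l, nrm (toPlane (q k) + s) < nrm (toPlane (q k)) := by
  have h1 : Tendsto (fun k => 2 * (dot s (toPlane (q k)) / nrm (toPlane (q k)))
      + dot s s * (nrm (toPlane (q k)))⁻¹) l (𝓝 (2 * dot s d + dot s s * 0)) :=
    ((tendsto_dot_div hq s).const_mul 2).add ((tendsto_inv_atTop_zero.comp hR).const_mul _)
  have h2 := h1.eventually (gt_mem_nhds (by linarith : 2 * dot s d + dot s s * 0 < 0))
  filter_upwards [h2, hR.eventually_gt_atTop 0] with k hk hpos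
  rw [nrm_lt_nrm_iff, dot_add_self]
  have := mul_neg_of_neg_of_pos hk hpos
  rw [add_mul, mul_assoc, div_mul_cancel₀ _ hpos.ne', mul_assoc, inv_mul_cancel₀ hpos.ne'] at this
  linarith

/-- Away from the chord of `a`, its truncation constraint is slack by an unbounded margin, so
bounded moves cannot violate it. -/
lemma eventually_sub_cross_lt (hR : Tendsto (fun k => nrm (toPlane (q k))) l atTop)
    (hq : Tendsto (fun k => (nrm (toPlane (q k)))⁻¹ • toPlane (q k)) l (𝓝 d)) {a : ℝ × ℝ}
    (ha : -1 < cross a d) (C : ℝ) :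
    ∀ᶠ k in l, C - cross a (toPlane (q k)) < nrm (toPlane (q k)) := by
  have h1 : Tendsto (fun k => C * (nrm (toPlane (q k)))⁻¹ -
      cross a (toPlane (q k)) / nrm (toPlane (q k))) l (𝓝 (C * 0 - cross a d)) :=
    ((tendsto_inv_atTop_zero.comp hR).const_mul _).sub (tendsto_cross_div hq a)
  have h2 := h1.eventually (gt_mem_nhds (by linarith : C * 0 - cross a d < 1))
  filter_upwards [h2, hR.eventually_gt_atTop 0] with k hk hpos
  have := mul_lt_mul_of_pos_right hk hpos
  rwa [sub_mul, mul_assoc, div_mul_cancel₀ _ hpos.ne', inv_mul_cancel₀ hpos.ne', mul_one,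
    one_mul] at this

end Direction

end PolygonalShift

/-! ### Coding of truncated discs -/

namespace PolygonalShift

open SymbolicDynamics.FullShift Filter Topology

/-- If a translate of a far away point of a truncated disc along a flat side leaves the disc, then
the point is far away on the flat side. -/
lemma eventually_lt_dot {l : Filter ℕ} {q : ℕ → ℤ × ℤ} {d ω : ℝ × ℝ} {r : ℕ → ℝ}
    (hr : Tendsto r l atTop) (hR : Tendsto (fun k => nrm (toPlane (q k))) l atTop)
    (hq : Tendsto (fun k => (nrm (toPlane (q k)))⁻¹ • toPlane (q k)) l (𝓝 d))
    (hω : dot ω ω = 1) (hωd : cross ω d = -1) {e : ℝ × ℝ} (he : e ≠ 0) (hωe : cross ω e = 0)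
    (hle : ∀ k, nrm (toPlane (q k)) ≤ r k ∧ 1 - cross ω (toPlane (q k)) ≤ r k)
    (hlt : ∀ᶠ k in l, r k < nrm (toPlane (q k) + e)) (B : ℝ) :
    ∀ᶠ k in l, B < dot e (toPlane (q k)) := by
  have hee := dot_self_pos he
  have hneg := (tendsto_cross_div hq ω).eventually (gt_mem_nhds (by linarith : cross ω d < 0))
  -- Comparing `r ^ 2` with `(r - 1) ^ 2` bounds `2 * r - 1` by `(e·p)² / (e·e) + 2 (e·p) + e·e`;
  -- the threshold exceeds this when `e·p ≤ B`.
  filter_upwards [hlt, hneg, hR.eventually_gt_atTop 0, hr.eventually_gt_atTop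
    (((|B| + dot e e) ^ 2 / dot e e + 2 * |B| + dot e e + 1) / 2)] with k hk hneg hpos hbig
  by_contra! hB
  set p := toPlane (q k)
  have hcr : cross ω p < 0 := by
    by_contra! h
    exact absurd hneg (not_lt.2 (div_nonneg h hpos.le))
  have h0 : 0 ≤ r k := hpos.le.trans (hle k).1
  have h1 : dot p p ≤ r k ^ 2 := (nrm_le_iff h0).1 (hle k).1
  have h2 : r k ^ 2 < dot p p + 2 * dot e p + dot e e := by
    rw [← dot_add_self]
    exact not_le.1 fun h => absurd ((nrm_le_iff h0).2 h) (not_le.2 hk)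
  have h3 : cross ω p ^ 2 ≤ (r k - 1) ^ 2 := by nlinarith [(hle k).2]
  have h4 : dot e e * dot p p = dot e e * cross ω p ^ 2 + dot e p ^ 2 := by
    have e1 : e.1 = dot ω e * ω.1 := by
      unfold dot cross at *; linear_combination (-e.1) * hω - ω.2 * hωe
    have e2 : e.2 = dot ω e * ω.2 := by
      unfold dot cross at *; linear_combination (-e.2) * hω + ω.1 * hωe
    have e3 : dot e p = dot ω e * dot ω p := by
      conv_lhs => unfold dot
      rw [e1, e2]; unfold dot; ring
    have e4 : dot e e = dot ω e ^ 2 := by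
      have := cross_sq_add_dot_sq ω e
      rw [hω, hωe] at this; linarith
    have e5 := cross_sq_add_dot_sq ω p
    rw [e3, e4]; linear_combination (-dot ω e ^ 2) * e5 - (dot ω e ^ 2 * dot p p) * hω
  -- The lower bound on `dot e p` comes from `h1` and `h2`, which give `2 (e·p) > -(e·e)`.
  have h5 : dot e p ^ 2 ≤ (|B| + dot e e) ^ 2 := by
    apply sq_le_sq'
    · linarith [abs_nonneg B]
    · linarith [le_abs_self B]
  have h6 : dot e e * ((|B| + dot e e) ^ 2 / dot e e) = (|B| + dot e e) ^ 2 := by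
    field_simp
  have h7 : dot e e * (2 * r k) >
      dot e e * ((|B| + dot e e) ^ 2 / dot e e + 2 * |B| + dot e e + 1) :=
    mul_lt_mul_of_pos_left (by linarith) hee
  have h8 := mul_lt_mul_of_pos_left h2 hee
  have h9 := mul_le_mul_of_nonneg_left h3 hee.le
  have h10 := mul_le_mul_of_nonneg_left (hB.trans (le_abs_self B)) hee.le
  nlinarith

variable {A : Type u} [TopologicalSpace A]

/-- Two elements of `X` which agree on the open half plane on the left of the unit vector `ω` and on
a ray of its boundary line agree at the origin. -/
def ClosesAt (X : Subshift A (ℤ × ℤ)) (ω : ℝ × ℝ) : Prop :=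
  ∀ e : ℤ × ℤ, e ≠ 0 → cross ω (toPlane e) = 0 → ∀ x ∈ X.carrier, ∀ x' ∈ X.carrier,
    (∀ p : ℤ × ℤ, 0 < cross ω (toPlane p) → x p = x' p) →
    (∀ p : ℤ × ℤ, cross ω (toPlane p) = 0 →
      dot (toPlane e) (toPlane p) ≤ -dot (toPlane e) (toPlane e) → x p = x' p) → x 0 = x' 0

lemma exists_cross_pos {w : ℝ × ℝ} (hw : w ≠ 0) : ∃ g : ℤ × ℤ, 0 < cross w (toPlane g) := by
  by_cases h1 : w.1 = 0
  · have h2 : w.2 ≠ 0 := fun h2 => hw (Prod.ext h1 h2)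
    rcases lt_or_gt_of_ne h2 with h | h
    · exact ⟨(1, 0), by simpa [cross, toPlane] using h⟩
    · exact ⟨(-1, 0), by simpa [cross, toPlane] using h⟩
  · rcases lt_or_gt_of_ne h1 with h | h
    · exact ⟨(0, -1), by simpa [cross, toPlane] using h⟩
    · exact ⟨(0, 1), by simpa [cross, toPlane] using h⟩

/-- If a closed half plane codes the plane then so does the open half plane. -/
lemma Codes.eq_of_open {X : Subshift A (ℤ × ℤ)} {w : ℝ × ℝ} (hw : w ≠ 0)
    (h : Codes X (halfPlane w) Set.univ) {x x' : ℤ × ℤ → A} (hx : x ∈ X.carrier)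
    (hx' : x' ∈ X.carrier) (hagree : ∀ p : ℤ × ℤ, 0 < cross w (toPlane p) → x p = x' p)
    (p : ℤ × ℤ) : x p = x' p := by
  obtain ⟨g, hg⟩ := exists_cross_pos hw
  have := h _ (X.mapsTo g hx) _ (X.mapsTo g hx') (fun z hz => hagree _ ?_) (p - g) trivial
  · simpa using this
  · rw [toPlane_add, cross_add_right]
    exact add_pos_of_pos_of_nonneg hg hz

/-- In a discrete alphabet each coordinate of a convergent family is eventually constant, so
agreement passes to limits. -/
lemma eq_of_tendsto_of_eventually_eq [DiscreteTopology A] {ι : Type*} {l : Filter ι} [l.NeBot]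
    {x x' : ι → ℤ × ℤ → A} {y y' : ℤ × ℤ → A} (hx : Tendsto x l (𝓝 y))
    (hx' : Tendsto x' l (𝓝 y')) (p : ℤ × ℤ) (h : ∀ᶠ k in l, x k p = x' k p) : y p = y' p := by
  have h1 := tendsto_pi_nhds.1 hx p
  have h2 := tendsto_pi_nhds.1 hx' p
  rw [nhds_discrete, tendsto_pure] at h1 h2
  obtain ⟨k, hk, hk1, hk2⟩ := (h.and (h1.and h2)).exists
  rw [← hk1, ← hk2, hk]

lemma isCompact_carrier [Finite A] [DiscreteTopology A] (X : Subshift A (ℤ × ℤ)) :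
    IsCompact X.carrier := X.isClosed.isCompact

variable {X : Subshift A (ℤ × ℤ)} {Ω : Finset (ℝ × ℝ)} {E : Set (ℤ × ℤ)}

/-- The removed caps miss the disc of radius `r - 1`. This sends the disagreements to infinity. -/
lemma nrm_ge_of_add_notMem (hunit : ∀ ω ∈ Ω, dot ω ω = 1) {p e : ℤ × ℤ} {r : ℝ}
    (h : p + e ∉ truncatedDisc Ω r) : r - 1 - nrm (toPlane e) ≤ nrm (toPlane p) := by
  have h1 : r - 1 ≤ nrm (toPlane (p + e)) := by
    by_contra! hlt
    refine h ⟨by linarith, fun ω hω => ?_⟩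
    have := (abs_le.1 (abs_cross_le ω (toPlane (p + e)))).1
    have h1 : nrm ω = 1 := by rw [nrm, hunit ω hω, Real.sqrt_one]
    rw [h1, one_mul] at this
    linarith
  have := nrm_add_le (toPlane p) (toPlane e)
  rw [← toPlane_add] at this
  linarith

/-- Limits of pairs of elements of `X` translated at a point of disagreement of minimal gauge. -/
lemma false_of_minimal_disagreement [Finite A] [DiscreteTopology A] (hΩ : Ω.Nonempty)
    (hunit : ∀ ω ∈ Ω, dot ω ω = 1)
    (hexp : ∀ ω : ℝ × ℝ, dot ω ω = 1 → ω ∉ Ω → Codes X (halfPlane ω) Set.univ)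
    (hclos : ∀ ω ∈ Ω, ClosesAt X ω) (hEne : E.Nonempty)
    (hE : ∀ ω ∈ Ω, ∃ e ∈ E, e ≠ 0 ∧ 0 ≤ cross ω (toPlane e))
    {r : ℕ → ℝ} (hr : Tendsto r atTop atTop) {x x' : ℕ → ℤ × ℤ → A} {q : ℕ → ℤ × ℤ}
    (hx : ∀ k, x k ∈ X.carrier) (hx' : ∀ k, x' k ∈ X.carrier)
    (hq : ∀ k, q k ∈ truncatedDisc Ω (r k)) (hne : ∀ k, x k (q k) ≠ x' k (q k))
    (hmin : ∀ k p, gauge Ω hΩ p < gauge Ω hΩ (q k) → x k p = x' k p)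
    (hagree : ∀ k, ∀ p ∈ truncatedDisc Ω (r k), ∀ e ∈ E, p + e ∈ truncatedDisc Ω (r k) →
      x k p = x' k p) : False := by
  have hout : ∀ k, ∀ e ∈ E, q k + e ∉ truncatedDisc Ω (r k) := fun k e he h =>
    hne k (hagree k _ (hq k) e he h)
  have hR0 : Tendsto (fun k => nrm (toPlane (q k))) atTop atTop := by
    obtain ⟨e, he⟩ := hEne
    refine tendsto_atTop_mono (fun k => nrm_ge_of_add_notMem hunit (hout k e he)) ?_
    exact tendsto_atTop_add_const_right _ _ (tendsto_atTop_add_const_right _ _ hr)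
  -- A single ultrafilter makes both translated configurations and the directions converge together.
  let l : Ultrafilter ℕ := Ultrafilter.of atTop
  have hl : (l : Filter ℕ) ≤ atTop := Ultrafilter.of_le _
  have hR : Tendsto (fun k => nrm (toPlane (q k))) l atTop := hR0.mono_left hl
  have hr' : Tendsto r l atTop := hr.mono_left hl
  obtain ⟨y, hy, hxy⟩ := (isCompact_carrier X).ultrafilter_le_nhds'
    (l.map fun k => shift (q k) (x k)) (Ultrafilter.mem_map.2 (univ_mem'
      fun k => X.mapsTo (q k) (hx k)))
  obtain ⟨y', hy', hxy'⟩ := (isCompact_carrier X).ultrafilter_le_nhds'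
    (l.map fun k => shift (q k) (x' k)) (Ultrafilter.mem_map.2 (univ_mem'
      fun k => X.mapsTo (q k) (hx' k)))
  have hcube : IsCompact (Set.Icc (-1 : ℝ) 1 ×ˢ Set.Icc (-1 : ℝ) 1) :=
    isCompact_Icc.prod isCompact_Icc
  obtain ⟨d, -, hd⟩ := hcube.ultrafilter_le_nhds'
    (l.map fun k => (nrm (toPlane (q k)))⁻¹ • toPlane (q k)) (Ultrafilter.mem_map.2 (univ_mem'
      fun k => by
        have h1 := abs_fst_le_nrm (toPlane (q k))
        have h2 := abs_snd_le_nrm (toPlane (q k))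
        have key : ∀ a R : ℝ, |a| ≤ R → R⁻¹ * a ∈ Set.Icc (-1 : ℝ) 1 := fun a R h => by
          rw [Set.mem_Icc, ← abs_le, abs_mul, abs_inv, abs_of_nonneg ((abs_nonneg a).trans h)]
          rw [inv_mul_eq_div]
          exact div_le_one_of_le₀ h ((abs_nonneg a).trans h)
        exact ⟨key _ _ h1, key _ _ h2⟩))
  replace hd : Tendsto (fun k => (nrm (toPlane (q k)))⁻¹ • toPlane (q k)) l (𝓝 d) := hd
  replace hxy : Tendsto (fun k => shift (q k) (x k)) l (𝓝 y) := hxy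
  replace hxy' : Tendsto (fun k => shift (q k) (x' k)) l (𝓝 y') := hxy'
  have hdd : dot d d = 1 := by
    have hc : Continuous fun p : ℝ × ℝ => dot p p := by unfold dot; fun_prop
    refine tendsto_nhds_unique ((hc.tendsto d).comp hd) ?_
    refine tendsto_const_nhds.congr' ?_
    filter_upwards [hR.eventually_gt_atTop 0] with k hk
    have := nrm_sq (toPlane (q k))
    simp only [Function.comp]
    have h2 : dot ((nrm (toPlane (q k)))⁻¹ • toPlane (q k)) ((nrm (toPlane (q k)))⁻¹ • toPlane (q k))
      = (nrm (toPlane (q k)))⁻¹ ^ 2 * dot (toPlane (q k)) (toPlane (q k)) := by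
      simp only [dot, Prod.smul_fst, Prod.smul_snd, smul_eq_mul]; ring
    rw [h2, ← this]
    field_simp
  have hy0 : y 0 ≠ y' 0 := by
    have h1 := tendsto_pi_nhds.1 hxy 0
    have h2 := tendsto_pi_nhds.1 hxy' 0
    rw [nhds_discrete, tendsto_pure] at h1 h2
    obtain ⟨k, hk1, hk2⟩ := (h1.and h2).exists
    rw [← hk1, ← hk2]
    simpa using hne k
  -- the direction of the boundary at the point of disagreement
  set ω : ℝ × ℝ := (-d.2, d.1) with hωdef
  have hωω : dot ω ω = 1 := by rw [← hdd]; simp only [dot, hωdef]; ring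
  have hω0 : ω ≠ 0 := by
    intro h; rw [h] at hωω; simp [dot] at hωω
  have hωd : cross ω d = -1 := by rw [← hdd]; simp only [cross, dot, hωdef]; ring
  have hωs : ∀ s, dot s d = -cross ω s := fun s => by simp only [cross, dot, hωdef]; ring
  -- Here `cross ω' d = -dot ω' ω`, which is `-1` only for equal unit vectors: only the chord of `ω`
  -- can matter near `q k`.
  have hother : ∀ ω' ∈ Ω, ω' ≠ ω → -1 < cross ω' d := by
    intro ω' hω' hneq
    have h1 := hunit ω' hω'
    have hlt : 0 < dot (ω' - ω) (ω' - ω) := dot_self_pos (sub_ne_zero.2 hneq)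
    simp only [dot, cross, hωdef, Prod.fst_sub, Prod.snd_sub] at *
    nlinarith
  -- An inward move shortens the norm and relaxes the constraint of `ω`; the other constraints are
  -- slack.
  have hdec : ∀ s : ℤ × ℤ, 0 < cross ω (toPlane s) →
      ∀ᶠ k in (l : Filter ℕ), gauge Ω hΩ (q k + s) < gauge Ω hΩ (q k) := by
    intro s hs
    have h1 := eventually_nrm_add_lt hR hd (s := toPlane s) (by rw [hωs]; linarith)
    have h2 : ∀ᶠ k in (l : Filter ℕ), ∀ ω' ∈ Ω, ω' ≠ ω →
        (1 - cross ω' (toPlane s)) - cross ω' (toPlane (q k)) < nrm (toPlane (q k)) := by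
      rw [Finset.eventually_all]
      intro ω' hω'
      by_cases h : ω' = ω
      · simp [h]
      · filter_upwards [eventually_sub_cross_lt hR hd (hother ω' hω' h) _] with k hk _ using hk
    filter_upwards [h1, h2] with k h1 h2
    obtain ⟨h3, h4⟩ := (gauge_le_iff hΩ).1 (le_refl (gauge Ω hΩ (q k)))
    rw [gauge_lt_iff, toPlane_add]
    refine ⟨h1.trans_le h3, fun ω' hω' => ?_⟩
    rw [cross_add_right]
    by_cases h : ω' = ω
    · subst h; linarith [h4 _ hω']
    · linarith [h2 ω' hω' h]
  have hopen : ∀ s : ℤ × ℤ, 0 < cross ω (toPlane s) → y s = y' s := by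
    intro s hs
    refine eq_of_tendsto_of_eventually_eq hxy hxy' s ?_
    filter_upwards [hdec s hs] with k hk
    exact hmin k _ hk
  by_cases hmem : ω ∈ Ω
  swap
  · exact hy0 ((hexp ω hωω hmem).eq_of_open hω0 hy hy' hopen 0)
  obtain ⟨e, heE, he0, hωe⟩ := hE ω hmem
  rcases hωe.lt_or_eq with hlt | heq
  · obtain ⟨k, hk⟩ := (hdec e hlt).exists
    exact hout k e heE ((gauge_le_iff hΩ).1 (hk.le.trans ((gauge_le_iff hΩ).2 (hq k))))
  -- A move along `ω` leaves its own constraint unchanged, so only the norm can take the point out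
  -- of the disc.
  have hpar : ∀ s : ℤ × ℤ, cross ω (toPlane s) = 0 → ∀ᶠ k in (l : Filter ℕ),
      nrm (toPlane (q k) + toPlane s) ≤ r k → q k + s ∈ truncatedDisc Ω (r k) := by
    intro s hs
    have h2 : ∀ᶠ k in (l : Filter ℕ), ∀ ω' ∈ Ω, ω' ≠ ω →
        (1 - cross ω' (toPlane s)) - cross ω' (toPlane (q k)) < nrm (toPlane (q k)) := by
      rw [Finset.eventually_all]
      intro ω' hω'
      by_cases h : ω' = ω
      · simp [h]
      · filter_upwards [eventually_sub_cross_lt hR hd (hother ω' hω' h) _] with k hk _ using hk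
    filter_upwards [h2] with k h2 hk
    refine ⟨by rwa [toPlane_add], fun ω' hω' => ?_⟩
    rw [toPlane_add, cross_add_right]
    by_cases h : ω' = ω
    · subst h; linarith [(hq k).2 _ hω']
    · linarith [h2 ω' hω' h, (hq k).1]
  have hfar : ∀ B : ℝ, ∀ᶠ k in (l : Filter ℕ), B < dot (toPlane e) (toPlane (q k)) := by
    refine eventually_lt_dot hr' hR hd hωω hωd (toPlane_ne_zero he0) heq.symm
      (fun k => ⟨(hq k).1, (hq k).2 ω hmem⟩) ?_
    filter_upwards [hpar e heq.symm] with k hk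
    by_contra! h
    exact hout k e heE (hk h)
  have hback : ∀ s : ℤ × ℤ, cross ω (toPlane s) = 0 → dot (toPlane e) (toPlane s) ≤ 0 →
      ∀ᶠ k in (l : Filter ℕ), q k + s ∈ truncatedDisc Ω (r k) := by
    intro s hs hes
    have hee := dot_self_pos (toPlane_ne_zero he0)
    obtain ⟨t, ht0, ht⟩ : ∃ t : ℝ, t ≤ 0 ∧ toPlane s = t • toPlane e := by
      refine ⟨dot (toPlane e) (toPlane s) / dot (toPlane e) (toPlane e),
        div_nonpos_of_nonpos_of_nonneg hes hee.le, ?_⟩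
      have hc : cross (toPlane e) (toPlane s) = 0 := by
        have h1 : cross (toPlane e) (toPlane s) * dot ω ω =
          dot ω (toPlane e) * cross ω (toPlane s) - cross ω (toPlane e) * dot ω (toPlane s) := by
          unfold cross dot; ring
        rw [hs, ← heq, hωω] at h1; linarith
      ext
      · simp only [Prod.smul_fst, smul_eq_mul]
        rw [div_mul_eq_mul_div, eq_div_iff hee.ne']
        unfold dot cross at *; linear_combination (-(toPlane e).2) * hc
      · simp only [Prod.smul_snd, smul_eq_mul]
        rw [div_mul_eq_mul_div, eq_div_iff hee.ne']
        unfold dot cross at *; linear_combination ((toPlane e).1) * hc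
    filter_upwards [hpar s hs, hfar (-t * dot (toPlane e) (toPlane e))] with k hk hB
    refine hk (le_trans ?_ (hq k).1)
    rw [nrm_le_iff (nrm_nonneg _), nrm_sq, dot_add_self, ht]
    have e1 : dot (t • toPlane e) (toPlane (q k)) = t * dot (toPlane e) (toPlane (q k)) := by
      simp only [dot, Prod.smul_fst, Prod.smul_snd, smul_eq_mul]; ring
    have e2 : dot (t • toPlane e) (t • toPlane e) = t * t * dot (toPlane e) (toPlane e) := by
      simp only [dot, Prod.smul_fst, Prod.smul_snd, smul_eq_mul]; ring
    rw [e1, e2]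
    nlinarith [mul_nonneg (neg_nonneg.2 ht0) (sub_nonneg.2 hB.le), mul_nonneg_of_nonpos_of_nonpos ht0 ht0]
  -- The ray starts at `-e`, so `p` and `p + e` are both behind the origin and `hback` keeps both
  -- translates in the disc, as `hagree` requires.
  refine hy0 (hclos ω hmem e he0 heq.symm y hy y' hy' hopen fun p hp hep => ?_)
  have hee := dot_self_pos (toPlane_ne_zero he0)
  refine eq_of_tendsto_of_eventually_eq hxy hxy' p ?_
  filter_upwards [hback p hp (by linarith), hback (p + e)
    (by rw [toPlane_add, cross_add_right, hp, ← heq, add_zero])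
    (by rw [toPlane_add, dot_add_right]; linarith)] with k h1 h2
  exact hagree k _ h1 e heE (by rwa [add_assoc])

/-- Elements of `X` which agree at the points of a large truncated disc that are moved inside the
disc by some vector of `E` agree on the disc. -/
theorem eventually_truncatedDisc_codes [Finite A] [DiscreteTopology A] (hΩ : Ω.Nonempty)
    (hunit : ∀ ω ∈ Ω, dot ω ω = 1)
    (hexp : ∀ ω : ℝ × ℝ, dot ω ω = 1 → ω ∉ Ω → Codes X (halfPlane ω) Set.univ)
    (hclos : ∀ ω ∈ Ω, ClosesAt X ω) (hEne : E.Nonempty)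
    (hE : ∀ ω ∈ Ω, ∃ e ∈ E, e ≠ 0 ∧ 0 ≤ cross ω (toPlane e)) :
    ∀ᶠ n : ℕ in atTop, ∀ x ∈ X.carrier, ∀ x' ∈ X.carrier,
      (∀ p ∈ truncatedDisc Ω n, ∀ e ∈ E, p + e ∈ truncatedDisc Ω n → x p = x' p) →
      ∀ p ∈ truncatedDisc Ω n, x p = x' p := by
  by_contra hcon
  rw [not_eventually] at hcon
  obtain ⟨φ, hφ, hfail⟩ := extraction_of_frequently_atTop hcon
  have key : ∀ k, ∃ x ∈ X.carrier, ∃ x' ∈ X.carrier, ∃ q ∈ truncatedDisc Ω (φ k : ℝ),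
      x q ≠ x' q ∧ (∀ p, gauge Ω hΩ p < gauge Ω hΩ q → x p = x' p) ∧
      ∀ p ∈ truncatedDisc Ω (φ k : ℝ), ∀ e ∈ E, p + e ∈ truncatedDisc Ω (φ k : ℝ) →
        x p = x' p := by
    intro k
    have := hfail k
    push Not at this
    obtain ⟨x, hx, x', hx', hag, p, hp, hne⟩ := this
    have hfin : {q | q ∈ truncatedDisc Ω (φ k : ℝ) ∧ x q ≠ x' q}.Finite :=
      (truncatedDisc_finite Ω _).subset fun _ h => h.1
    obtain ⟨q, ⟨hq1, hq2⟩, hq⟩ := hfin.exists_minimalFor (gauge Ω hΩ) _ ⟨p, hp, hne⟩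
    refine ⟨x, hx, x', hx', q, hq1, hq2, fun p hp => ?_, hag⟩
    by_contra h
    have hpm : p ∈ truncatedDisc Ω (φ k : ℝ) :=
      (gauge_le_iff hΩ).1 (hp.le.trans ((gauge_le_iff hΩ).2 hq1))
    exact absurd (hq ⟨hpm, h⟩ hp.le) (not_le.2 hp)
  choose x hx x' hx' q hq hne hmin hag using key
  exact false_of_minimal_disagreement hΩ hunit hexp hclos hEne hE
    (tendsto_natCast_atTop_atTop.comp hφ.tendsto_atTop) hx hx' hq hne hmin hag

end PolygonalShift

/-! ### Periods and one-sided sets of directions -/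

namespace PolygonalShift

open SymbolicDynamics.FullShift Filter Topology

variable {A : Type u} [TopologicalSpace A] {X : Subshift A (ℤ × ℤ)}

/-- If finitely many classes of elements of `X` determine the values on the backward half of the
orbit of `0` under translation by `a`, then a multiple of `a` is a period of `X`. -/
lemma exists_period {κ : Type*} [Finite κ] (f : X.carrier → κ) (a : ℤ × ℤ)
    (h : ∀ x x' : X.carrier, f x = f x' → ∀ t : ℕ, x.1 (-(t • a)) = x'.1 (-(t • a))) :
    ∃ N : ℕ, 0 < N ∧ ∀ x ∈ X.carrier, Function.Periodic x (N • a) := by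
  set K := Nat.card κ with hK
  have hzero : ∀ x ∈ X.carrier, x (-(K.factorial • a)) = x 0 := by
    intro x hx
    -- Pigeonhole: one more translate than there are classes.
    let s : Fin (K + 1) → X.carrier := fun i => ⟨shift ((i : ℕ) • a) x, X.mapsTo _ hx⟩
    have hinj : ¬ Function.Injective (f ∘ s) := by
      intro hinj
      have := Nat.card_le_card_of_injective _ hinj
      simp at this
      omega
    obtain ⟨i, j, hij, hlt⟩ : ∃ i j : Fin (K + 1), f (s i) = f (s j) ∧ i < j := by
      simp only [Function.Injective, not_forall] at hinj
      obtain ⟨i, j, hij, hne⟩ := hinj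
      rcases lt_or_gt_of_ne hne with hlt | hlt
      · exact ⟨i, j, hij, hlt⟩
      · exact ⟨j, i, hij.symm, hlt⟩
    obtain ⟨d, hd⟩ := Nat.exists_eq_add_of_lt (show (i : ℕ) < j from hlt)
    have hstep : ∀ m : ℕ, x (-(m • a)) = x ((d + 1) • a - m • a) := by
      intro m
      have := h _ _ hij (m + i)
      simp only [s, shift_apply, hd] at this
      convert this using 2
      · rw [add_smul]; abel
      · rw [add_smul, add_smul, add_smul, add_smul]; abel
    have hmul : ∀ c : ℕ, x (-((c * (d + 1)) • a)) = x 0 := by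
      intro c
      induction c with
      | zero => simp
      | succ c ih =>
        rw [hstep, ← ih]
        congr 1
        rw [Nat.succ_mul, add_smul (c * (d + 1))]; abel
    -- The step `d + 1 ≤ K` depends on `x`; its multiple `K !` does not.
    obtain ⟨c, hc⟩ := Nat.dvd_factorial (Nat.succ_pos d) (by have := j.2; omega : d + 1 ≤ K)
    rw [hc, mul_comm]
    exact hmul c
  refine ⟨K.factorial, Nat.factorial_pos _, fun x hx p => ?_⟩
  have := hzero _ (X.mapsTo (p + K.factorial • a) hx)
  simpa using this.symm

/-- A period which is not parallel to a half plane makes the half plane code the plane. -/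
lemma codes_halfPlane_of_periodic {c : ℤ × ℤ} (hc : ∀ x ∈ X.carrier, Function.Periodic x c)
    {w : ℝ × ℝ} (hw : cross w (toPlane c) ≠ 0) : Codes X (halfPlane w) Set.univ := by
  intro x hx x' hx' h p _
  have hlin : ∀ m : ℤ, cross w (toPlane (p + m • c)) =
      cross w (toPlane p) + m * cross w (toPlane c) := by
    intro m; simp [cross, toPlane]; ring
  obtain ⟨m, hm⟩ : ∃ m : ℤ, 0 ≤ cross w (toPlane (p + m • c)) := by
    obtain ⟨n, hn⟩ := exists_nat_ge (|cross w (toPlane p)| / |cross w (toPlane c)|)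
    rw [div_le_iff₀ (abs_pos.2 hw)] at hn
    have h1 := neg_abs_le (cross w (toPlane p))
    rcases lt_or_gt_of_ne hw with h | h
    · refine ⟨-n, ?_⟩
      rw [hlin]; rw [abs_of_neg h] at hn; push_cast; linarith
    · refine ⟨n, ?_⟩
      rw [hlin]; rw [abs_of_pos h] at hn; push_cast; linarith
  have := h _ hm
  rwa [(hc x hx).zsmul m p, (hc x' hx').zsmul m p] at this

/-- With finitely many elements, each can serve as its own class in `exists_period`, giving a period
transverse to `w`. -/
lemma infinite_of_not_codes {w : ℝ × ℝ} (hw : w ≠ 0)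
    (h : ¬ Codes X (halfPlane w) Set.univ) : X.carrier.Infinite := by
  intro hfin
  have : Finite X.carrier := hfin
  obtain ⟨g, hg⟩ := exists_cross_pos hw
  obtain ⟨N, hN, hper⟩ := exists_period (X := X) id g (by rintro x x' rfl t; rfl)
  refine h (codes_halfPlane_of_periodic hper ?_)
  have : cross w (toPlane (N • g)) = N * cross w (toPlane g) := by
    simp [cross, toPlane]; ring
  rw [this]
  positivity

/-- Nonexpansive directions do not lie on one side of a rational line, unless they are all parallel
to it. -/
theorem cross_eq_zero_of_one_sided [Finite A] [DiscreteTopology A] {Ω : Finset (ℝ × ℝ)}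
    (hΩ : Ω.Nonempty) (hunit : ∀ ω ∈ Ω, dot ω ω = 1)
    (hexp : ∀ ω : ℝ × ℝ, dot ω ω = 1 → ω ∉ Ω → Codes X (halfPlane ω) Set.univ)
    (hnon : ∀ ω ∈ Ω, ¬ Codes X (halfPlane ω) Set.univ)
    (hclos : ∀ ω ∈ Ω, ClosesAt X ω) {a : ℤ × ℤ} (ha : a ≠ 0)
    (hside : ∀ ω ∈ Ω, cross ω (toPlane a) ≤ 0) : ∀ ω ∈ Ω, cross ω (toPlane a) = 0 := by
  have hE : ∀ ω ∈ Ω, ∃ e ∈ ({-a} : Set (ℤ × ℤ)), e ≠ 0 ∧ 0 ≤ cross ω (toPlane e) := by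
    intro ω hω
    refine ⟨-a, rfl, neg_ne_zero.2 ha, ?_⟩
    have := hside ω hω
    simp [cross, toPlane] at *; linarith
  obtain ⟨n, hcode, hn⟩ := ((eventually_truncatedDisc_codes hΩ hunit hexp hclos
    (Set.singleton_nonempty _) hE).and (eventually_ge_atTop 1)).exists
  have : Finite (truncatedDisc Ω (n : ℝ)) := truncatedDisc_finite Ω n
  have h0 : (0 : ℤ × ℤ) ∈ truncatedDisc Ω (n : ℝ) :=
    zero_mem_truncatedDisc Ω (by exact_mod_cast hn)
  -- The class of `x` is its pattern on the disc: each further translate of the disc by `-a` is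
  -- coded by its overlap with the preceding one.
  obtain ⟨N, hN, hper⟩ := exists_period (X := X)
    (fun x (p : truncatedDisc Ω (n : ℝ)) => x.1 p.1) a (by
      intro x x' hf t
      have key : ∀ t : ℕ, ∀ p ∈ truncatedDisc Ω (n : ℝ),
          x.1 (-(t • a) + p) = x'.1 (-(t • a) + p) := by
        intro t
        induction t with
        | zero => intro p hp; simpa using congrFun hf ⟨p, hp⟩
        | succ t ih =>
          refine hcode _ (X.mapsTo (-((t + 1) • a)) x.2) _ (X.mapsTo (-((t + 1) • a)) x'.2) ?_
          rintro p - e rfl hpe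
          have := ih _ hpe
          simp only [shift_apply]
          convert this using 2 <;> (rw [add_smul, one_smul]; abel)
      simpa using key t 0 h0)
  intro ω hω
  by_contra hne
  refine hnon ω hω (codes_halfPlane_of_periodic hper ?_)
  have : cross ω (toPlane (N • a)) = N * cross ω (toPlane a) := by
    simp [cross, toPlane]; ring
  rw [this]
  positivity

lemma exists_pos_smul_of_ray_eq {v w : ℝ × ℝ} (hv : v ≠ 0) (hw : w ≠ 0)
    (h : rayOfNeZero ℝ v hv = rayOfNeZero ℝ w hw) : ∃ c : ℝ, 0 < c ∧ v = c • w := by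
  rw [ray_eq_iff] at h
  obtain ⟨c, hc, h⟩ := h.exists_pos_right hv hw
  exact ⟨c, hc, h⟩

lemma cross_smul_left (c : ℝ) (p q : ℝ × ℝ) : cross (c • p) q = c * cross p q := by
  simp only [cross, Prod.smul_fst, Prod.smul_snd, smul_eq_mul]; ring

/-- Translation by `-z` brings `L₀` to the line through the origin and the closed half plane into
the open one. The block from `z - e` to `z - N • e` has at least `N` lattice points and lands in the
ray. -/
lemma IsClosing.closesAt {ρ : Module.Ray ℝ (ℝ × ℝ)} (h : IsClosing X ρ) {ω : ℝ × ℝ} (hω : ω ≠ 0)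
    (hρ : rayOfNeZero ℝ ω hω = ρ) : ClosesAt X ω := by
  obtain ⟨-, -, w, hw, hwρ, z, ⟨hz, -⟩, N, hN, hcode⟩ := h
  obtain ⟨c, hc, rfl⟩ := exists_pos_smul_of_ray_eq hw hω (hwρ.trans hρ.symm)
  intro e he hωe x hx x' hx' hopen hray
  have hωω := dot_self_pos hω
  have hee := dot_self_pos (toPlane_ne_zero he)
  obtain ⟨s, hs⟩ : ∃ s : ℝ, toPlane e = s • c • ω := by
    refine ⟨dot ω (toPlane e) / (c * dot ω ω), ?_⟩
    ext
    · simp only [Prod.smul_fst, smul_eq_mul]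
      field_simp
      unfold dot cross at *; linear_combination (-ω.2) * hωe
    · simp only [Prod.smul_snd, smul_eq_mul]
      field_simp
      unfold dot cross at *; linear_combination (ω.1) * hωe
  set a : ℝ × ℝ := toPlane z - toPlane e with ha
  set b : ℝ × ℝ := toPlane z - (N : ℝ) • toPlane e with hb
  have hseg : ∀ p : ℤ × ℤ, toPlane p ∈ segment ℝ a b → ∃ t : ℝ, 1 ≤ t ∧ t ≤ N ∧
      toPlane p = toPlane z - t • toPlane e := by
    rintro p ⟨t1, t2, h1, h2, h12, h⟩
    have hN1 : (1 : ℝ) ≤ N := by exact_mod_cast hN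
    refine ⟨t1 + t2 * N, by nlinarith, by nlinarith, ?_⟩
    rw [← h, ha, hb]
    obtain rfl : t1 = 1 - t2 := by linarith
    module
  have hfin : {y : ℤ × ℤ | toPlane y ∈ segment ℝ a b}.Finite := by
    refine (finite_nrm_le (nrm (toPlane z) + N * nrm (toPlane e))).subset fun p hp => ?_
    obtain ⟨t, ht1, htN, ht⟩ := hseg p hp
    rw [Set.mem_ofPred_eq, ht, sub_eq_add_neg]
    refine (nrm_add_le _ _).trans (add_le_add le_rfl ?_)
    rw [nrm_le_iff (mul_nonneg (Nat.cast_nonneg _) (nrm_nonneg _)), mul_pow, nrm_sq]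
    have : dot (-(t • toPlane e)) (-(t • toPlane e)) = t ^ 2 * dot (toPlane e) (toPlane e) := by
      simp only [dot, Prod.fst_neg, Prod.snd_neg, Prod.smul_fst, Prod.smul_snd, smul_eq_mul]; ring
    rw [this]
    gcongr
  have hcard : N ≤ {y : ℤ × ℤ | toPlane y ∈ segment ℝ a b}.ncard := by
    have hinj : Function.Injective fun j : ℕ => z - j • e := by
      intro i j hij
      simp only [sub_right_inj] at hij
      by_contra hne
      refine he (smul_right_injective (ℤ × ℤ) (sub_ne_zero.2 (Nat.cast_injective.ne hne :
        (i : ℤ) ≠ j)) ?_)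
      simp only [smul_zero, sub_smul, natCast_zsmul, hij, sub_self]
    have h1 : ((Finset.Icc 1 N : Finset ℕ) : Set ℕ).ncard = N := by
      rw [Set.ncard_coe_finset]; simp
    conv_lhs => rw [← h1, ← Set.ncard_image_of_injective _ hinj]
    refine Set.ncard_le_ncard ?_ hfin
    rintro _ ⟨j, hj, rfl⟩
    simp only [Finset.coe_Icc, Set.mem_Icc] at hj
    have hj1 : (1 : ℝ) ≤ j := by exact_mod_cast hj.1
    have hjN : (j : ℝ) ≤ N := by exact_mod_cast hj.2
    have hpt : toPlane (z - j • e) = toPlane z - (j : ℝ) • toPlane e := by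
      rw [toPlane_sub]; simp [toPlane]
    simp only [Set.mem_ofPred_eq, hpt]
    -- For `N = 1` the segment is a point and the division by `N - 1` below would fail.
    rcases eq_or_lt_of_le (hj1.trans hjN) with h | h
    · have hj' : (j : ℝ) = 1 := by linarith
      rw [hj', one_smul]
      exact left_mem_segment _ _ _
    · refine ⟨(N - j) / (N - 1), (j - 1) / (N - 1), div_nonneg (by linarith) (by linarith),
        div_nonneg (by linarith) (by linarith), ?_, ?_⟩
      · have : (N : ℝ) - 1 ≠ 0 := by linarith
        field_simp; ring
      · have : (N : ℝ) - 1 ≠ 0 := by linarith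
        rw [ha, hb]
        ext <;> simp <;> field_simp <;> ring
  have hline : ∀ t : ℝ, toPlane z - t • toPlane e ∈ latticeLine (c • ω) z := by
    intro t
    refine ⟨-(t * s), ?_⟩
    rw [hs]; module
  have key := hcode a (by simpa using hline 1) b (hline N) hcard _ (X.mapsTo (-z) hx) _
    (X.mapsTo (-z) hx') (fun p hp => ?_) z (Or.inr ⟨0, by simp⟩)
  · simpa using key
  · simp only [shift_apply]
    rcases hp with hp | hp
    · refine hopen _ ?_
      simp only [halfPlane, Set.mem_ofPred_eq, not_le, cross_smul_left] at hp hz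
      have h1 := nonneg_of_mul_nonneg_right hp hc
      have h2 : cross ω (toPlane z) < 0 := by
        by_contra! h; exact absurd hz (not_lt.2 (mul_nonneg hc.le h))
      have : cross ω (toPlane (-z + p)) = cross ω (toPlane p) - cross ω (toPlane z) := by
        simp only [cross, toPlane_add, toPlane_neg, Prod.fst_add, Prod.snd_add, Prod.fst_neg,
          Prod.snd_neg]; ring
      linarith
    · obtain ⟨t, ht1, -, ht⟩ := hseg p hp
      have hpt : toPlane (-z + p) = -(t • toPlane e) := by
        rw [toPlane_add, toPlane_neg, ht]; abel
      refine hray _ ?_ ?_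
      · rw [hpt]
        have : cross ω (-(t • toPlane e)) = -t * cross ω (toPlane e) := by
          simp only [cross, Prod.fst_neg, Prod.snd_neg, Prod.smul_fst, Prod.smul_snd, smul_eq_mul]
          ring
        rw [this, hωe, mul_zero]
      · rw [hpt]
        have : dot (toPlane e) (-(t • toPlane e)) = -(t * dot (toPlane e) (toPlane e)) := by
          simp only [dot, Prod.fst_neg, Prod.snd_neg, Prod.smul_fst, Prod.smul_snd, smul_eq_mul]
          ring
        rw [this]
        nlinarith

end PolygonalShift

/-! ### Positive integer relations between directions -/

namespace PolygonalShift

lemma cross_toPlane (p q : ℤ × ℤ) :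
    cross (toPlane p) (toPlane q) = ((p.1 * q.2 - p.2 * q.1 : ℤ) : ℝ) := by
  simp [cross, toPlane]

lemma dot_toPlane (p q : ℤ × ℤ) :
    dot (toPlane p) (toPlane q) = ((p.1 * q.1 + p.2 * q.2 : ℤ) : ℝ) := by
  simp [dot, toPlane]

/-- If no rational line has all the vectors of `Z` on one side, except for a line containing all of
them, then each vector of `Z` is in a relation with nonnegative coefficients. -/
lemma exists_relation_of_mem {Z : Finset (ℤ × ℤ)} (h0 : ∀ z ∈ Z, z ≠ 0)
    (H : ∀ a : ℤ × ℤ, a ≠ 0 → (∀ z ∈ Z, cross (toPlane z) (toPlane a) ≤ 0) →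
      ∀ z ∈ Z, cross (toPlane z) (toPlane a) = 0) {w : ℤ × ℤ} (hw : w ∈ Z) :
    ∃ z ∈ Z, ∃ y ∈ Z, ∃ α β γ : ℤ, 0 < α ∧ 0 ≤ β ∧ 0 ≤ γ ∧ α • w + β • z + γ • y = 0 := by
  simp only [cross_toPlane, Int.cast_nonpos, Int.cast_eq_zero] at H
  have hww : 0 < w.1 * w.1 + w.2 * w.2 := by
    have := dot_self_pos (toPlane_ne_zero (h0 w hw))
    rw [dot_toPlane] at this; exact_mod_cast this
  by_cases hpar : ∀ z ∈ Z, z.1 * w.2 - z.2 * w.1 = 0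
  -- On a single line, `H` applied to a normal of `w` yields a vector opposite to `w`.
  · obtain ⟨z, hz, hzw⟩ : ∃ z ∈ Z, z.1 * w.1 + z.2 * w.2 < 0 := by
      by_contra! hcon
      have := H (w.2, -w.1) (fun h => h0 w hw (by
        simp only [Prod.ext_iff, Prod.fst_zero, Prod.snd_zero, neg_eq_zero] at h ⊢
        exact h.symm)) (fun z hz => by
          have := hcon z hz
          simp only; linarith) w hw
      simp only at this
      linarith
    refine ⟨z, hz, z, hz, -(z.1 * w.1 + z.2 * w.2), w.1 * w.1 + w.2 * w.2, 0, by linarith,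
      hww.le, le_rfl, ?_⟩
    have := hpar z hz
    ext
    · simp; linear_combination w.2 * this
    · simp; linear_combination (-w.1) * this
  · have hneg : ∀ a : ℤ × ℤ, a ≠ 0 → (∃ z ∈ Z, z.1 * a.2 - z.2 * a.1 ≠ 0) →
        ∃ z ∈ Z, 0 < z.1 * a.2 - z.2 * a.1 := by
      rintro a ha ⟨z, hz, hne⟩
      by_contra! hcon
      exact hne (H a ha hcon z hz)
    obtain ⟨z₀, hz₀, hz₀w⟩ : ∃ z ∈ Z, 0 < w.1 * z.2 - w.2 * z.1 := by
      push Not at hpar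
      obtain ⟨z, hz, hne⟩ := hpar
      obtain ⟨y, hy, hpos⟩ := hneg (-w) (neg_ne_zero.2 (h0 w hw)) ⟨z, hz, by
        simp only [Prod.fst_neg, Prod.snd_neg]
        intro h; apply hne; linarith⟩
      refine ⟨y, hy, ?_⟩
      simp only [Prod.fst_neg, Prod.snd_neg] at hpos
      linarith
    -- Minimal cotangent means that `z` makes the largest angle with `w` among the vectors strictly
    -- left of `w`; any `y` left of `z` is then not strictly left of `w`.
    obtain ⟨z, hz, hmin⟩ := (Z.filter fun z => 0 < w.1 * z.2 - w.2 * z.1).exists_min_image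
      (fun z => ((w.1 * z.1 + w.2 * z.2 : ℤ) : ℚ) / ((w.1 * z.2 - w.2 * z.1 : ℤ) : ℚ))
      ⟨z₀, Finset.mem_filter.2 ⟨hz₀, hz₀w⟩⟩
    obtain ⟨hz, hzw⟩ := Finset.mem_filter.1 hz
    obtain ⟨y, hy, hzy⟩ := hneg (-z) (neg_ne_zero.2 (h0 z hz)) ⟨w, hw, by
      simp only [Prod.fst_neg, Prod.snd_neg]; intro h; linarith⟩
    simp only [Prod.fst_neg, Prod.snd_neg] at hzy
    have hwy : w.1 * y.2 - w.2 * y.1 ≤ 0 := by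
      by_contra! hpos
      have := hmin y (Finset.mem_filter.2 ⟨hy, hpos⟩)
      rw [div_le_div_iff₀ (by exact_mod_cast hzw) (by exact_mod_cast hpos)] at this
      have h2 : (w.1 * z.1 + w.2 * z.2) * (w.1 * y.2 - w.2 * y.1) ≤
        (w.1 * y.1 + w.2 * y.2) * (w.1 * z.2 - w.2 * z.1) := by exact_mod_cast this
      nlinarith [mul_pos hww hzy]
    -- Cramer's identity `(z × y) w - (w × y) z + (w × z) y = 0`.
    refine ⟨z, hz, y, hy, z.1 * y.2 - z.2 * y.1, -(w.1 * y.2 - w.2 * y.1),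
      w.1 * z.2 - w.2 * z.1, by linarith, by linarith, hzw.le, ?_⟩
    ext <;> simp <;> ring

/-- Add, over all `w ∈ Z`, relations with nonnegative coefficients that are positive at `w`. -/
lemma exists_pos_relation {Z : Finset (ℤ × ℤ)} (h0 : ∀ z ∈ Z, z ≠ 0)
    (H : ∀ a : ℤ × ℤ, a ≠ 0 → (∀ z ∈ Z, cross (toPlane z) (toPlane a) ≤ 0) →
      ∀ z ∈ Z, cross (toPlane z) (toPlane a) = 0) :
    ∃ c : ℤ × ℤ → ℤ, (∀ z ∈ Z, 0 < c z) ∧ ∑ z ∈ Z, c z • z = 0 := by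
  have key : ∀ w : ℤ × ℤ, ∃ c : ℤ × ℤ → ℤ, w ∈ Z → 0 < c w ∧ (∀ z, 0 ≤ c z) ∧
      ∑ z ∈ Z, c z • z = 0 := by
    intro w
    by_cases hw : w ∈ Z
    swap
    · exact ⟨0, fun h => absurd h hw⟩
    obtain ⟨z, hz, y, hy, α, β, γ, hα, hβ, hγ, h⟩ := exists_relation_of_mem h0 H hw
    refine ⟨fun v => (if v = w then α else 0) + (if v = z then β else 0) +
      (if v = y then γ else 0), fun _ => ⟨?_, fun v => ?_, ?_⟩⟩
    · have h1 : 0 ≤ if w = z then β else 0 := by split_ifs <;> simp [hβ]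
      have h2 : 0 ≤ if w = y then γ else 0 := by split_ifs <;> simp [hγ]
      simp only [if_true]; linarith
    · have h1 : 0 ≤ if v = w then α else 0 := by split_ifs <;> simp [hα.le]
      have h2 : 0 ≤ if v = z then β else 0 := by split_ifs <;> simp [hβ]
      have h3 : 0 ≤ if v = y then γ else 0 := by split_ifs <;> simp [hγ]
      linarith
    · simp only [add_smul, Finset.sum_add_distrib, ite_smul, zero_smul, Finset.sum_ite_eq', hw, hz,
        hy, if_true]
      exact h
  choose c hc using key
  refine ⟨fun z => ∑ w ∈ Z, c w z, fun z hz => ?_, ?_⟩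
  · exact Finset.sum_pos' (fun w hw => (hc w hw).2.1 z) ⟨z, hz, (hc z hz).1⟩
  · simp only [Finset.sum_smul]
    rw [Finset.sum_comm]
    exact Finset.sum_eq_zero fun w hw => (hc w hw).2.2

/-! ### Arguments and lexicographic half planes -/

/-- The argument of a vector, in `(-π, π]`. -/
noncomputable def ang (p : ℝ × ℝ) : ℝ := Complex.arg ⟨p.1, p.2⟩

lemma ang_le_pi (p : ℝ × ℝ) : ang p ≤ Real.pi := Complex.arg_le_pi _

lemma neg_pi_lt_ang (p : ℝ × ℝ) : -Real.pi < ang p := Complex.neg_pi_lt_arg _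

lemma cross_eq_sin (p q : ℝ × ℝ) : ∃ R : ℝ, 0 ≤ R ∧ (p ≠ 0 → q ≠ 0 → 0 < R) ∧
    cross p q = R * Real.sin (ang q - ang p) ∧ dot p q = R * Real.cos (ang q - ang p) := by
  have h1 := Complex.norm_mul_cos_arg ⟨p.1, p.2⟩
  have h2 := Complex.norm_mul_sin_arg ⟨p.1, p.2⟩
  have h3 := Complex.norm_mul_cos_arg ⟨q.1, q.2⟩
  have h4 := Complex.norm_mul_sin_arg ⟨q.1, q.2⟩
  refine ⟨‖(⟨p.1, p.2⟩ : ℂ)‖ * ‖(⟨q.1, q.2⟩ : ℂ)‖, by positivity, fun hp hq => ?_, ?_, ?_⟩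
  · refine mul_pos (norm_pos_iff.2 fun h => hp ?_) (norm_pos_iff.2 fun h => hq ?_)
    · simpa [Complex.ext_iff, Prod.ext_iff] using h
    · simpa [Complex.ext_iff, Prod.ext_iff] using h
  · rw [Real.sin_sub]; unfold ang cross
    set R := ‖(⟨p.1, p.2⟩ : ℂ)‖
    linear_combination (-q.2) * h1 - R * Real.cos (Complex.arg ⟨p.1, p.2⟩) * h4 + q.1 * h2 +
      R * Real.sin (Complex.arg ⟨p.1, p.2⟩) * h3
  · rw [Real.cos_sub]; unfold ang dot
    set R := ‖(⟨p.1, p.2⟩ : ℂ)‖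
    linear_combination (-q.1) * h1 - R * Real.cos (Complex.arg ⟨p.1, p.2⟩) * h3 - q.2 * h2 -
      R * Real.sin (Complex.arg ⟨p.1, p.2⟩) * h4

/-- The lexicographic half plane on the left of `d`; the sign `σ` says which half of the
boundary line it contains. -/
def LexHalf (σ : ℝ) (d p : ℝ × ℝ) : Prop := 0 < cross d p ∨ cross d p = 0 ∧ 0 ≤ σ * dot d p

end PolygonalShift

namespace PolygonalShift

lemma LexHalf.zero (σ : ℝ) (d : ℝ × ℝ) : LexHalf σ d 0 := by
  right; simp [cross, dot]

lemma LexHalf.add {σ : ℝ} {d p q : ℝ × ℝ} (hp : LexHalf σ d p) (hq : LexHalf σ d q) :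
    LexHalf σ d (p + q) := by
  unfold LexHalf at *
  rw [cross_add_right, dot_add_right, mul_add]
  rcases hp with hp | hp <;> rcases hq with hq | hq
  · left; linarith
  · left; linarith
  · left; linarith
  · right; constructor <;> linarith

lemma LexHalf.sum {ι : Type*} {σ : ℝ} {d : ℝ × ℝ} (s : Finset ι) (f : ι → ℝ × ℝ)
    (h : ∀ i ∈ s, LexHalf σ d (f i)) : LexHalf σ d (∑ i ∈ s, f i) :=
  Finset.sum_induction f (LexHalf σ d) (fun _ _ => LexHalf.add) (LexHalf.zero σ d) h

lemma dot_smul_right (c : ℝ) (p q : ℝ × ℝ) : dot p (c • q) = c * dot p q := by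
  simp only [dot, Prod.smul_fst, Prod.smul_snd, smul_eq_mul]; ring

lemma cross_smul_right (c : ℝ) (p q : ℝ × ℝ) : cross p (c • q) = c * cross p q := by
  simp only [cross, Prod.smul_fst, Prod.smul_snd, smul_eq_mul]; ring

lemma LexHalf.smul {σ : ℝ} {d p : ℝ × ℝ} (hp : LexHalf σ d p) {c : ℝ} (hc : 0 ≤ c) :
    LexHalf σ d (c • p) := by
  rcases hc.eq_or_lt with rfl | hc
  · rw [zero_smul]; exact LexHalf.zero σ d
  unfold LexHalf at *
  rw [cross_smul_right, dot_smul_right]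
  rcases hp with hp | ⟨hp, hp'⟩
  · left; positivity
  · right
    refine ⟨by rw [hp, mul_zero], ?_⟩
    rw [mul_left_comm]
    positivity

lemma LexHalf.cross_nonneg {σ : ℝ} {d p : ℝ × ℝ} (hp : LexHalf σ d p) : 0 ≤ cross d p :=
  hp.elim le_of_lt fun h => h.1.ge

lemma eq_zero_of_cross_eq_zero {d p : ℝ × ℝ} (hd : d ≠ 0) (hc : cross d p = 0)
    (ht : dot d p = 0) : p = 0 := by
  have h := cross_sq_add_dot_sq d p
  rw [hc, ht] at h
  by_contra hp
  nlinarith [mul_pos (dot_self_pos hd) (dot_self_pos hp)]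

lemma LexHalf.eq_zero {σ : ℝ} (hσ : σ ≠ 0) {d p : ℝ × ℝ} (hd : d ≠ 0) (h : LexHalf σ d p)
    (h' : LexHalf σ d (-p)) : p = 0 := by
  have e1 : cross d (-p) = -cross d p := by simp [cross]; ring
  have e2 : dot d (-p) = -dot d p := by simp [dot]; ring
  unfold LexHalf at h h'
  rw [e1, e2] at h'
  have hc : cross d p = 0 := by
    rcases h with h | h <;> rcases h' with h' | h' <;> linarith
  have ht : σ * dot d p = 0 := by
    rcases h with h | h <;> rcases h' with h' | h' <;> linarith
  exact eq_zero_of_cross_eq_zero hd hc ((mul_eq_zero.1 ht).resolve_left hσ)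

lemma convex_lexHalf (σ : ℝ) (d v : ℝ × ℝ) : Convex ℝ {p | LexHalf σ d (p - v)} := by
  intro p hp q hq a b ha hb hab
  have : a • p + b • q - v = a • (p - v) + b • (q - v) := by
    obtain rfl : b = 1 - a := by linarith
    module
  rw [Set.mem_ofPred_eq, this]
  exact (LexHalf.smul hp ha).add (LexHalf.smul hq hb)

/-- A point of a convex set which is minimal for a lexicographic order is extreme. -/
lemma mem_extremePoints_of_lexHalf {σ : ℝ} (hσ : σ ≠ 0) {d : ℝ × ℝ} (hd : d ≠ 0)
    {P : Set (ℝ × ℝ)} {v : ℝ × ℝ} (hv : v ∈ P) (h : ∀ p ∈ P, LexHalf σ d (p - v)) :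
    v ∈ P.extremePoints ℝ := by
  rw [mem_extremePoints]
  have key : ∀ p ∈ P, ∀ q ∈ P, v ∈ openSegment ℝ p q → p = v := by
    rintro p hp q hq ⟨a, b, ha, hb, hab, hv⟩
    refine sub_eq_zero.1 (LexHalf.eq_zero hσ hd (h p hp) ?_)
    have : -(p - v) = (b / a) • (q - v) := by
      have h1 : a • -(p - v) = b • (q - v) := by
        rw [← hv]
        obtain rfl : b = 1 - a := by linarith
        module
      rw [div_eq_inv_mul, mul_smul, ← h1, inv_smul_smul₀ ha.ne']
    rw [this]
    exact (h q hq).smul (by positivity)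
  refine ⟨hv, fun p hp q hq hpq => ⟨key p hp q hq hpq, key q hq p hp ?_⟩⟩
  rwa [openSegment_symm]

section Ang

variable {d w : ℝ × ℝ}

lemma lexHalf_of_sin_pos {σ : ℝ} (hd : d ≠ 0) (hw : w ≠ 0)
    (h : 0 < Real.sin (ang w - ang d)) : LexHalf σ d w := by
  obtain ⟨R, -, hR, hc, -⟩ := cross_eq_sin d w
  left; rw [hc]; exact mul_pos (hR hd hw) h

lemma lexHalf_neg_of_sin_neg {σ : ℝ} (hd : d ≠ 0) (hw : w ≠ 0)
    (h : Real.sin (ang w - ang d) < 0) : LexHalf σ d (-w) := by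
  obtain ⟨R, -, hR, hc, -⟩ := cross_eq_sin d w
  left
  have : cross d (-w) = -cross d w := by simp [cross]; ring
  rw [this, hc, ← mul_neg]; exact mul_pos (hR hd hw) (neg_pos.2 h)

lemma sin_ang_sub_pos (h : 0 < ang w - ang d ∧ ang w - ang d < Real.pi ∨
    ang w - ang d < -Real.pi) : 0 < Real.sin (ang w - ang d) := by
  rcases h with h | h
  · exact Real.sin_pos_of_pos_of_lt_pi h.1 h.2
  · rw [← Real.sin_add_two_pi]
    apply Real.sin_pos_of_pos_of_lt_pi <;> linarith [ang_le_pi d, neg_pi_lt_ang w]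

lemma sin_ang_sub_neg (h : -Real.pi < ang w - ang d ∧ ang w - ang d < 0 ∨
    Real.pi < ang w - ang d) : Real.sin (ang w - ang d) < 0 := by
  rcases h with h | h
  · exact Real.sin_neg_of_neg_of_neg_pi_lt h.2 h.1
  · rw [← Real.sin_sub_two_pi]
    apply Real.sin_neg_of_neg_of_neg_pi_lt <;> linarith [ang_le_pi w, neg_pi_lt_ang d]

/-- The hypothesis is that the angle from `d` to `w` lies in `(0, π]` modulo `2π`; `π` is included
because `σ = -1` keeps the backward half of the boundary line. -/
lemma lexHalf_neg_one_of_ang (hd : d ≠ 0) (hw : w ≠ 0)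
    (h : 0 < ang w - ang d ∧ ang w - ang d ≤ Real.pi ∨ ang w - ang d < -Real.pi) :
    LexHalf (-1) d w := by
  by_cases hpi : ang w - ang d = Real.pi
  · obtain ⟨R, hR, -, hc, ht⟩ := cross_eq_sin d w
    right
    rw [hc, ht, hpi]; simpa using hR
  · exact lexHalf_of_sin_pos hd hw (sin_ang_sub_pos
      (h.imp (fun h => ⟨h.1, lt_of_le_of_ne h.2 hpi⟩) id))

lemma lexHalf_neg_one_neg_of_ang (hd : d ≠ 0) (hw : w ≠ 0)
    (h : -Real.pi < ang w - ang d ∧ ang w - ang d ≤ 0 ∨ Real.pi < ang w - ang d) :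
    LexHalf (-1) d (-w) := by
  by_cases h0 : ang w - ang d = 0
  · obtain ⟨R, hR, -, hc, ht⟩ := cross_eq_sin d w
    right
    have e1 : cross d (-w) = -cross d w := by simp [cross]; ring
    have e2 : dot d (-w) = -dot d w := by simp [dot]; ring
    rw [e1, e2, hc, ht, h0]; simpa using hR
  · exact lexHalf_neg_of_sin_neg hd hw (sin_ang_sub_neg
      (h.imp (fun h => ⟨h.1, lt_of_le_of_ne h.2 h0⟩) id))

lemma lexHalf_one_of_ang (hd : d ≠ 0) (hw : w ≠ 0)
    (h : 0 ≤ ang w - ang d ∧ ang w - ang d < Real.pi ∨ ang w - ang d < -Real.pi) :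
    LexHalf 1 d w := by
  by_cases h0 : ang w - ang d = 0
  · obtain ⟨R, hR, -, hc, ht⟩ := cross_eq_sin d w
    right
    rw [hc, ht, h0]; simpa using hR
  · exact lexHalf_of_sin_pos hd hw (sin_ang_sub_pos
      (h.imp (fun h => ⟨lt_of_le_of_ne h.1 (Ne.symm h0), h.2⟩) id))

lemma lexHalf_one_neg_of_ang (hd : d ≠ 0) (hw : w ≠ 0)
    (h : -Real.pi < ang w - ang d ∧ ang w - ang d < 0 ∨ Real.pi < ang w - ang d) :
    LexHalf 1 d (-w) :=
  lexHalf_neg_of_sin_neg hd hw (sin_ang_sub_neg h)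

end Ang

/-! ### The polygon with prescribed edges -/

lemma toPlane_sum {ι : Type*} (s : Finset ι) (f : ι → ℤ × ℤ) :
    toPlane (∑ i ∈ s, f i) = ∑ i ∈ s, toPlane (f i) :=
  map_sum (AddMonoidHom.mk' toPlane toPlane_add) f s

/-- The sum of the vectors of `W` of argument at most `θ`. -/
noncomputable def partialSum (W : Finset (ℤ × ℤ)) (θ : ℝ) : ℤ × ℤ :=
  ∑ w ∈ W with ang (toPlane w) ≤ θ, w

/-- The sum of the vectors of `W` of argument less than `θ`. -/
noncomputable def partialSumLt (W : Finset (ℤ × ℤ)) (θ : ℝ) : ℤ × ℤ :=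
  ∑ w ∈ W with ang (toPlane w) < θ, w

variable {W : Finset (ℤ × ℤ)}

/-- A difference of two sums over subsets of `W`, up to multiples of the vanishing full sum. -/
lemma lexHalf_sub_of_terms (hsum : ∑ w ∈ W, w = 0) {σ : ℝ} {d : ℝ × ℝ} (I J : ℤ × ℤ → Prop)
    [DecidablePred I] [DecidablePred J] (c : ℝ)
    (h : ∀ w ∈ W, LexHalf σ d
      (((if I w then 1 else 0) - (if J w then 1 else 0) + c : ℝ) • toPlane w)) :
    LexHalf σ d (toPlane (∑ w ∈ W with I w, w) - toPlane (∑ w ∈ W with J w, w)) := by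
  have h1 : ∑ w ∈ W, toPlane w = 0 := by rw [← toPlane_sum, hsum, toPlane_zero]
  have h2 : toPlane (∑ w ∈ W with I w, w) - toPlane (∑ w ∈ W with J w, w) =
      ∑ w ∈ W, (((if I w then 1 else 0) - (if J w then 1 else 0) + c : ℝ) • toPlane w) := by
    rw [toPlane_sum, toPlane_sum]
    simp only [add_smul, sub_smul, Finset.sum_add_distrib, Finset.sum_sub_distrib,
      ← Finset.smul_sum, h1, smul_zero, add_zero, Finset.sum_filter, ite_smul,
      one_smul, zero_smul]
  rw [h2]
  exact LexHalf.sum _ _ h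

/-- The difference is, up to sign, the sum of the vectors with arguments between `ang d` and `θ`.
When these are more than `π` apart, adding or subtracting the vanishing total sum passes to the
complementary vectors, so every term is in the half plane. Thus the vertex at `ang d` is where an
edge of direction `d` ends. -/
lemma lexHalf_partialSum (hsum : ∑ w ∈ W, w = 0) (h0 : ∀ w ∈ W, w ≠ 0) {d : ℝ × ℝ} (hd : d ≠ 0)
    {θ : ℝ} (hθ : -Real.pi < θ) (hθ' : θ ≤ Real.pi) :
    LexHalf (-1) d (toPlane (partialSum W θ) - toPlane (partialSum W (ang d))) := by
  have hd1 := ang_le_pi d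
  have hd2 := neg_pi_lt_ang d
  have hz := LexHalf.zero (-1) d
  rcases lt_or_ge (ang d + Real.pi) θ with h | h
  · refine lexHalf_sub_of_terms hsum _ _ (-1) fun w hw => ?_
    have h1 := @lexHalf_neg_one_of_ang d (toPlane w) hd (toPlane_ne_zero (h0 w hw))
    have h2 := @lexHalf_neg_one_neg_of_ang d (toPlane w) hd (toPlane_ne_zero (h0 w hw))
    have hw1 := ang_le_pi (toPlane w)
    have hw2 := neg_pi_lt_ang (toPlane w)
    by_cases hI : ang (toPlane w) ≤ θ <;> by_cases hJ : ang (toPlane w) ≤ ang d <;>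
      simp only [hI, hJ, if_true, if_false] <;> norm_num
    · exact h2 (Or.inl ⟨by linarith, by linarith⟩)
    · exact hz
    · exact absurd hJ (by linarith)
    · exact h2 (Or.inr (by linarith))
  rcases lt_or_ge θ (ang d - Real.pi) with h' | h'
  · refine lexHalf_sub_of_terms hsum _ _ 1 fun w hw => ?_
    have h1 := @lexHalf_neg_one_of_ang d (toPlane w) hd (toPlane_ne_zero (h0 w hw))
    have h2 := @lexHalf_neg_one_neg_of_ang d (toPlane w) hd (toPlane_ne_zero (h0 w hw))
    have hw1 := ang_le_pi (toPlane w)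
    have hw2 := neg_pi_lt_ang (toPlane w)
    by_cases hI : ang (toPlane w) ≤ θ <;> by_cases hJ : ang (toPlane w) ≤ ang d <;>
      simp only [hI, hJ, if_true, if_false] <;> norm_num
    · exact h1 (Or.inr (by linarith))
    · exact absurd hJ (by linarith)
    · exact hz
    · exact h1 (Or.inl ⟨by linarith, by linarith⟩)
  · refine lexHalf_sub_of_terms hsum _ _ 0 fun w hw => ?_
    have h1 := @lexHalf_neg_one_of_ang d (toPlane w) hd (toPlane_ne_zero (h0 w hw))
    have h2 := @lexHalf_neg_one_neg_of_ang d (toPlane w) hd (toPlane_ne_zero (h0 w hw))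
    by_cases hI : ang (toPlane w) ≤ θ <;> by_cases hJ : ang (toPlane w) ≤ ang d <;>
      simp only [hI, hJ, if_true, if_false] <;> norm_num
    · exact hz
    · exact h1 (Or.inl ⟨by linarith, by linarith⟩)
    · exact h2 (Or.inl ⟨by linarith, by linarith⟩)
    · exact hz

/-- The same argument for the vertex where an edge of direction `d` starts; strict and weak
inequalities change places since the forward half line is now kept. -/
lemma lexHalf_partialSumLt (hsum : ∑ w ∈ W, w = 0) (h0 : ∀ w ∈ W, w ≠ 0) {d : ℝ × ℝ} (hd : d ≠ 0)
    {θ : ℝ} (hθ : -Real.pi < θ) (hθ' : θ ≤ Real.pi) :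
    LexHalf 1 d (toPlane (partialSum W θ) - toPlane (partialSumLt W (ang d))) := by
  have hd1 := ang_le_pi d
  have hd2 := neg_pi_lt_ang d
  have hz := LexHalf.zero 1 d
  rcases le_or_gt (ang d + Real.pi) θ with h | h
  · refine lexHalf_sub_of_terms hsum _ _ (-1) fun w hw => ?_
    have h1 := @lexHalf_one_of_ang d (toPlane w) hd (toPlane_ne_zero (h0 w hw))
    have h2 := @lexHalf_one_neg_of_ang d (toPlane w) hd (toPlane_ne_zero (h0 w hw))
    have hw1 := ang_le_pi (toPlane w)
    have hw2 := neg_pi_lt_ang (toPlane w)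
    by_cases hI : ang (toPlane w) ≤ θ <;> by_cases hJ : ang (toPlane w) < ang d <;>
      simp only [hI, hJ, if_true, if_false] <;> norm_num
    · exact h2 (Or.inl ⟨by linarith, by linarith⟩)
    · exact hz
    · exact absurd hJ (by linarith)
    · exact h2 (Or.inr (by linarith))
  rcases lt_or_ge θ (ang d - Real.pi) with h' | h'
  · refine lexHalf_sub_of_terms hsum _ _ 1 fun w hw => ?_
    have h1 := @lexHalf_one_of_ang d (toPlane w) hd (toPlane_ne_zero (h0 w hw))
    have h2 := @lexHalf_one_neg_of_ang d (toPlane w) hd (toPlane_ne_zero (h0 w hw))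
    have hw1 := ang_le_pi (toPlane w)
    have hw2 := neg_pi_lt_ang (toPlane w)
    by_cases hI : ang (toPlane w) ≤ θ <;> by_cases hJ : ang (toPlane w) < ang d <;>
      simp only [hI, hJ, if_true, if_false] <;> norm_num
    · exact h1 (Or.inr (by linarith))
    · exact absurd hJ (by linarith)
    · exact hz
    · exact h1 (Or.inl ⟨by linarith, by linarith⟩)
  · refine lexHalf_sub_of_terms hsum _ _ 0 fun w hw => ?_
    have h1 := @lexHalf_one_of_ang d (toPlane w) hd (toPlane_ne_zero (h0 w hw))
    have h2 := @lexHalf_one_neg_of_ang d (toPlane w) hd (toPlane_ne_zero (h0 w hw))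
    by_cases hI : ang (toPlane w) ≤ θ <;> by_cases hJ : ang (toPlane w) < ang d <;>
      simp only [hI, hJ, if_true, if_false] <;> norm_num
    · exact hz
    · exact h1 (Or.inl ⟨by linarith, by linarith⟩)
    · exact h2 (Or.inl ⟨by linarith, by linarith⟩)
    · exact hz

/-- The vertices of the polygon whose edges are the vectors of `W`. -/
noncomputable def polygonVertices (W : Finset (ℤ × ℤ)) : Finset (ℤ × ℤ) :=
  W.image fun w => partialSum W (ang (toPlane w))

/-- The convex polygon whose edges are the vectors of `W`. -/
noncomputable def polygonOf (W : Finset (ℤ × ℤ)) : Set (ℝ × ℝ) :=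
  convexHull ℝ (toPlane '' (polygonVertices W : Set (ℤ × ℤ)))

/-- The largest argument below `θ` gives the vertex; if there is none, the empty sum equals the
total sum, the vertex at the largest argument of all. -/
lemma partialSumLt_mem (hsum : ∑ w ∈ W, w = 0) (hne : W.Nonempty) (θ : ℝ) :
    partialSumLt W θ ∈ polygonVertices W := by
  rcases (W.filter fun w => ang (toPlane w) < θ).eq_empty_or_nonempty with h | h
  · obtain ⟨m, hm, hmax⟩ := W.exists_max_image (fun w => ang (toPlane w)) hne
    refine Finset.mem_image.2 ⟨m, hm, ?_⟩
    rw [partialSum, partialSumLt, h, Finset.sum_empty, Finset.filter_true_of_mem hmax, hsum]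
  · obtain ⟨m, hm, hmax⟩ := Finset.exists_max_image _ (fun w => ang (toPlane w)) h
    rw [Finset.mem_filter] at hm
    refine Finset.mem_image.2 ⟨m, hm.1, ?_⟩
    rw [partialSum, partialSumLt]
    refine Finset.sum_congr (Finset.filter_congr fun w hw => ⟨fun h => h.trans_lt hm.2, fun h =>
      hmax w (Finset.mem_filter.2 ⟨hw, h⟩)⟩) fun _ _ => rfl

lemma polygonOf_lexHalf_neg_one (hsum : ∑ w ∈ W, w = 0) (h0 : ∀ w ∈ W, w ≠ 0) {d : ℝ × ℝ}
    (hd : d ≠ 0) : ∀ p ∈ polygonOf W, LexHalf (-1) d (p - toPlane (partialSum W (ang d))) := by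
  refine fun p hp => convexHull_min ?_ (convex_lexHalf (-1) d _) hp
  rintro _ ⟨v, hv, rfl⟩
  obtain ⟨w, hw, rfl⟩ := Finset.mem_image.1 hv
  exact lexHalf_partialSum hsum h0 hd (neg_pi_lt_ang _) (ang_le_pi _)

lemma polygonOf_lexHalf_one (hsum : ∑ w ∈ W, w = 0) (h0 : ∀ w ∈ W, w ≠ 0) {d : ℝ × ℝ}
    (hd : d ≠ 0) : ∀ p ∈ polygonOf W, LexHalf 1 d (p - toPlane (partialSumLt W (ang d))) := by
  refine fun p hp => convexHull_min ?_ (convex_lexHalf 1 d _) hp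
  rintro _ ⟨v, hv, rfl⟩
  obtain ⟨w, hw, rfl⟩ := Finset.mem_image.1 hv
  exact lexHalf_partialSumLt hsum h0 hd (neg_pi_lt_ang _) (ang_le_pi _)

lemma toPlane_mem_polygonOf {v : ℤ × ℤ} (hv : v ∈ polygonVertices W) : toPlane v ∈ polygonOf W :=
  subset_convexHull ℝ _ ⟨v, hv, rfl⟩

/-- Every vector of `W` is an oriented edge of the polygon. -/
lemma exists_orientedEdge (hsum : ∑ w ∈ W, w = 0) (h0 : ∀ w ∈ W, w ≠ 0)
    (hinj : Set.InjOn (fun w => ang (toPlane w)) W) {w : ℤ × ℤ} (hw : w ∈ W) :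
    ∃ a ∈ polygonVertices W, ∃ b ∈ polygonVertices W,
      IsOrientedEdge (polygonOf W) (toPlane a) (toPlane b) ∧ toPlane b - toPlane a = toPlane w := by
  have hw0 := toPlane_ne_zero (h0 w hw)
  have ha := partialSumLt_mem hsum ⟨w, hw⟩ (ang (toPlane w))
  have hb : partialSum W (ang (toPlane w)) ∈ polygonVertices W := Finset.mem_image_of_mem _ hw
  have hab : partialSum W (ang (toPlane w)) = partialSumLt W (ang (toPlane w)) + w := by
    have : (W.filter fun v => ang (toPlane v) ≤ ang (toPlane w)) =
        insert w (W.filter fun v => ang (toPlane v) < ang (toPlane w)) := by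
      ext v
      simp only [Finset.mem_filter, Finset.mem_insert]
      constructor
      · rintro ⟨hv, hle⟩
        rcases hle.lt_or_eq with h | h
        · exact Or.inr ⟨hv, h⟩
        · exact Or.inl (hinj hv hw h)
      · rintro (rfl | ⟨hv, h⟩)
        · exact ⟨hw, le_rfl⟩
        · exact ⟨hv, h.le⟩
    rw [partialSum, partialSumLt, this, Finset.sum_insert (by simp), add_comm]
  have hsub : toPlane (partialSum W (ang (toPlane w))) -
      toPlane (partialSumLt W (ang (toPlane w))) = toPlane w := by
    rw [hab, toPlane_add]; abel
  refine ⟨_, ha, _, hb, ⟨?_, ?_, fun h => ?_, fun p hp => ?_⟩, hsub⟩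
  · exact mem_extremePoints_of_lexHalf one_ne_zero hw0 (toPlane_mem_polygonOf ha)
      (polygonOf_lexHalf_one hsum h0 hw0)
  · exact mem_extremePoints_of_lexHalf (neg_ne_zero.2 one_ne_zero) hw0 (toPlane_mem_polygonOf hb)
      (polygonOf_lexHalf_neg_one hsum h0 hw0)
  · rw [h, sub_self] at hsub
    exact hw0 hsub.symm
  · rw [hsub]
    exact (polygonOf_lexHalf_one hsum h0 hw0 p hp).cross_nonneg

/-- Every oriented edge of the polygon has the direction of a vector of `W`. -/
lemma exists_ang_eq_of_isOrientedEdge (hsum : ∑ w ∈ W, w = 0) (h0 : ∀ w ∈ W, w ≠ 0)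
    (hne : W.Nonempty) {a b : ℝ × ℝ} (h : IsOrientedEdge (polygonOf W) a b) :
    ∃ w ∈ W, ang (toPlane w) = ang (b - a) := by
  obtain ⟨ha, hb, hab, hleft⟩ := h
  have hd : b - a ≠ 0 := sub_ne_zero.2 hab.symm
  by_contra! hcon
  -- The minima for the two lexicographic orders then coincide, so `cross (b - a)` has a unique
  -- minimizer on the polygon, although both `a` and `b` minimize it.
  have heq : partialSum W (ang (b - a)) = partialSumLt W (ang (b - a)) :=
    Finset.sum_congr (Finset.filter_congr fun w hw => ⟨fun h => lt_of_le_of_ne h (hcon w hw),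
      le_of_lt⟩) fun _ _ => rfl
  set v := toPlane (partialSumLt W (ang (b - a))) with hv
  have hvP : v ∈ polygonOf W := toPlane_mem_polygonOf (partialSumLt_mem hsum hne _)
  have h1 := polygonOf_lexHalf_one hsum h0 hd
  have h2 := polygonOf_lexHalf_neg_one hsum h0 hd
  rw [heq, ← hv] at h2
  rw [← hv] at h1
  have key : ∀ p ∈ polygonOf W, cross (b - a) (p - a) = 0 → p = v := by
    intro p hp hpa
    have e : cross (b - a) (p - v) = cross (b - a) (p - a) - cross (b - a) (v - a) := by
      simp only [cross, Prod.fst_sub, Prod.snd_sub]; ring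
    have hc : cross (b - a) (p - v) = 0 := by
      linarith [(h1 p hp).cross_nonneg, hleft v hvP]
    refine sub_eq_zero.1 (eq_zero_of_cross_eq_zero hd hc ?_)
    rcases h1 p hp with h1 | h1
    · linarith
    rcases h2 p hp with h2 | h2
    · linarith
    linarith
  refine hab ((key a ha.1 ?_).trans (key b hb.1 ?_).symm)
  · simp [cross]
  · simp only [cross]; ring

lemma ang_eq_iff {p q : ℝ × ℝ} (hp : p ≠ 0) (hq : q ≠ 0) :
    ang p = ang q ↔ rayOfNeZero ℝ p hp = rayOfNeZero ℝ q hq := by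
  rw [ray_eq_iff]
  constructor
  · intro h
    obtain ⟨R, -, hR, hc, ht⟩ := cross_eq_sin p q
    have hR := hR hp hq
    rw [h, sub_self, Real.sin_zero, mul_zero] at hc
    rw [h, sub_self, Real.cos_zero, mul_one] at ht
    refine Or.inr (Or.inr ⟨R, dot p p, hR, dot_self_pos hp, ?_⟩)
    rw [← ht]
    ext
    · simp only [dot, cross, Prod.smul_fst, smul_eq_mul] at *; linear_combination p.2 * hc
    · simp only [dot, cross, Prod.smul_snd, smul_eq_mul] at *; linear_combination (-p.1) * hc
  · intro h
    obtain ⟨c, hc, rfl⟩ := h.exists_pos_right hp hq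
    unfold ang
    rw [← Complex.arg_real_mul ⟨q.1, q.2⟩ hc]
    congr 1
    apply Complex.ext <;> simp

end PolygonalShift

/-! ### Recoding by patterns on translates of a finite set -/

namespace PolygonalShift

open SymbolicDynamics.FullShift Filter Topology

section Recoding

variable {A : Type u} (F : Finset (ℤ × ℤ))

/-- The block map sending `x` to the configuration of its patterns on the translates of `F`. -/
def blockMap (x : ℤ × ℤ → A) : ℤ × ℤ → (F → A) := fun p f => x (f.1 + p)

lemma continuous_blockMap [TopologicalSpace A] : Continuous (blockMap (A := A) F) := by
  unfold blockMap; fun_prop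

lemma blockMap_injective (hF : F.Nonempty) : Function.Injective (blockMap (A := A) F) := by
  obtain ⟨f, hf⟩ := hF
  intro x x' h
  funext p
  have := congrFun (congrFun h (p - f)) ⟨f, hf⟩
  simpa [blockMap] using this

lemma blockMap_shift (g : ℤ × ℤ) (x : ℤ × ℤ → A) :
    blockMap F (shift g x) = shift g (blockMap F x) := by
  funext p f
  simp only [blockMap, shift_apply]
  congr 1; abel

variable [TopologicalSpace A] [Finite A] [DiscreteTopology A] (X : Subshift A (ℤ × ℤ))

/-- The subshift of the patterns on the translates of `F` of the elements of `X`. -/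
def blockShift : Subshift (F → A) (ℤ × ℤ) where
  carrier := blockMap F '' X.carrier
  isClosed := ((isCompact_carrier X).image (continuous_blockMap F)).isClosed
  mapsTo := by
    rintro g _ ⟨x, hx, rfl⟩
    exact ⟨shift g x, X.mapsTo g hx, blockMap_shift F g x⟩

lemma isRecoding_blockShift (hF : F.Nonempty) : IsRecoding X (blockShift F X) := by
  have : CompactSpace X.carrier := isCompact_iff_compactSpace.1 (isCompact_carrier X)
  let e : X.carrier ≃ (blockShift F X).carrier :=
    Equiv.Set.image (blockMap F) X.carrier (blockMap_injective F hF)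
  have he : Continuous e := by
    refine Continuous.subtype_mk ((continuous_blockMap F).comp continuous_subtype_val) _
  refine ⟨F, he.homeoOfEquivCompactToT2, fun g x => blockMap_shift F g x.1, fun p x x' => ?_⟩
  change blockMap F x.1 p = blockMap F x'.1 p ↔ _
  simp [blockMap, funext_iff]

end Recoding

end PolygonalShift

/-! ### The main theorem -/

open PolygonalShift SymbolicDynamics.FullShift Filter Topology

theorem theorem5p13 {A : Type u} [Finite A] [TopologicalSpace A] [DiscreteTopology A]
    (X : SymbolicDynamics.FullShift.Subshift A (ℤ × ℤ))
    (hfinite : {ρ | PolygonalShift.IsNonexpansive X ρ}.Finite)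
    (hnonempty : {ρ | PolygonalShift.IsNonexpansive X ρ}.Nonempty)
    (hclosing : ∀ ρ, PolygonalShift.IsNonexpansive X ρ →
      PolygonalShift.IsRational ρ ∧ PolygonalShift.IsClosing X ρ) :
    ∃ (B : Type u) (_ : Finite B) (_ : TopologicalSpace B) (_ : DiscreteTopology B)
      (Y : SymbolicDynamics.FullShift.Subshift B (ℤ × ℤ)) (P : Set (ℝ × ℝ)),
      PolygonalShift.IsRecoding X Y ∧
      PolygonalShift.IsPolygonal Y P ∧
      (∀ a b, PolygonalShift.IsOrientedEdge P a b →
        ∃ ρ, PolygonalShift.IsNonexpansive X ρ ∧ PolygonalShift.PositivelyParallel a b ρ) ∧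
      (∀ ρ, PolygonalShift.IsNonexpansive X ρ →
        ∃ a b, PolygonalShift.IsOrientedEdge P a b ∧ PolygonalShift.PositivelyParallel a b ρ) := by
  classical
  -- lattice vectors and unit vectors in the nonexpansive directions
  have hrat : ∀ ρ : Module.Ray ℝ (ℝ × ℝ), ∃ z : ℤ × ℤ, IsNonexpansive X ρ →
      ∃ hz : toPlane z ≠ 0, rayOfNeZero ℝ (toPlane z) hz = ρ := by
    intro ρ
    by_cases h : IsNonexpansive X ρ
    · obtain ⟨z, hz⟩ := (hclosing ρ h).1
      exact ⟨z, fun _ => hz⟩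
    · exact ⟨0, fun h' => absurd h' h⟩
  choose z hz using hrat
  set Z : Finset (ℤ × ℤ) := hfinite.toFinset.image z with hZ
  have memZ : ∀ {v}, v ∈ Z ↔ ∃ ρ, IsNonexpansive X ρ ∧ z ρ = v := by
    intro v; simp [hZ]
  have hZ0 : ∀ v ∈ Z, v ≠ 0 := by
    intro v hv
    obtain ⟨ρ, hρ, rfl⟩ := memZ.1 hv
    intro h0
    exact (hz ρ hρ).1 (by rw [h0, toPlane_zero])
  have hZne : Z.Nonempty := by
    obtain ⟨ρ, hρ⟩ := hnonempty
    exact ⟨z ρ, memZ.2 ⟨ρ, hρ, rfl⟩⟩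
  let unit : ℤ × ℤ → ℝ × ℝ := fun v => (nrm (toPlane v))⁻¹ • toPlane v
  have hdotsmul : ∀ (c : ℝ) (p : ℝ × ℝ), dot (c • p) (c • p) = c ^ 2 * dot p p := by
    intro c p; simp only [dot, Prod.smul_fst, Prod.smul_snd, smul_eq_mul]; ring
  have hposZ : ∀ v ∈ Z, 0 < nrm (toPlane v) := fun v hv => nrm_pos (toPlane_ne_zero (hZ0 v hv))
  set Ω : Finset (ℝ × ℝ) := Z.image unit with hΩdef
  have hΩne : Ω.Nonempty := hZne.image _
  have memΩ : ∀ {ω}, ω ∈ Ω ↔ ∃ v ∈ Z, unit v = ω := by intro ω; simp [hΩdef]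
  have hunit : ∀ ω ∈ Ω, dot ω ω = 1 := by
    intro ω hω
    obtain ⟨v, hv, rfl⟩ := memΩ.1 hω
    have := hposZ v hv
    simp only [unit]
    rw [hdotsmul, ← nrm_sq]
    field_simp
  have hcross : ∀ v ∈ Z, ∀ p, cross (unit v) p = (nrm (toPlane v))⁻¹ * cross (toPlane v) p :=
    fun v _ p => cross_smul_left _ _ _
  have hΩ0 : ∀ ω ∈ Ω, ω ≠ 0 := by
    intro ω hω h
    have := hunit ω hω
    rw [h] at this; simp [dot] at this
  have hΩray : ∀ ω (hω : ω ∈ Ω), IsNonexpansive X (rayOfNeZero ℝ ω (hΩ0 ω hω)) := by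
    intro ω hω
    obtain ⟨v, hv, rfl⟩ := memΩ.1 hω
    obtain ⟨ρ, hρ, rfl⟩ := memZ.1 hv
    obtain ⟨h0, hray⟩ := hz ρ hρ
    convert hρ
    refine Eq.trans ?_ hray
    rw [ray_eq_iff]
    exact SameRay.sameRay_pos_smul_left _ (inv_pos.2 (hposZ _ hv))
  have hcodes_smul : ∀ (c : ℝ) (w : ℝ × ℝ), 0 < c → halfPlane (c • w) = halfPlane w := by
    intro c w hc
    ext p
    simp only [halfPlane, Set.mem_ofPred_eq, cross_smul_left]
    exact mul_nonneg_iff_of_pos_left hc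
  have hnon : ∀ ω ∈ Ω, ¬ Codes X (halfPlane ω) Set.univ := by
    intro ω hω
    obtain ⟨w, hw, hray, hcode⟩ := hΩray ω hω
    obtain ⟨c, hc, rfl⟩ := exists_pos_smul_of_ray_eq hw (hΩ0 ω hω) hray
    rwa [hcodes_smul c ω hc] at hcode
  have hexp : ∀ ω : ℝ × ℝ, dot ω ω = 1 → ω ∉ Ω → Codes X (halfPlane ω) Set.univ := by
    intro ω h1 hω
    by_contra hcode
    have h0 : ω ≠ 0 := by
      intro h; rw [h] at h1; simp [dot] at h1
    have hρ : IsNonexpansive X (rayOfNeZero ℝ ω h0) := ⟨ω, h0, rfl, hcode⟩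
    have hv : z (rayOfNeZero ℝ ω h0) ∈ Z := memZ.2 ⟨_, hρ, rfl⟩
    obtain ⟨hz0, hray⟩ := hz _ hρ
    obtain ⟨c, hc, hcω⟩ := exists_pos_smul_of_ray_eq hz0 h0 hray
    refine hω (memΩ.2 ⟨_, hv, ?_⟩)
    have hn : nrm (toPlane (z (rayOfNeZero ℝ ω h0))) = c := by
      rw [nrm, hcω, hdotsmul, h1, mul_one, Real.sqrt_sq hc.le]
    simp only [unit]
    rw [hn, hcω, inv_smul_smul₀ hc.ne']
  have hclos : ∀ ω ∈ Ω, ClosesAt X ω := fun ω hω =>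
    (hclosing _ (hΩray ω hω)).2.closesAt (hΩ0 ω hω) rfl
  -- the polygon
  obtain ⟨c, hc, hrel⟩ := exists_pos_relation hZ0 (fun a ha hside v hv => by
    have := cross_eq_zero_of_one_sided hΩne hunit hexp hnon hclos ha (fun ω hω => by
      obtain ⟨v, hv, rfl⟩ := memΩ.1 hω
      rw [hcross v hv]
      exact mul_nonpos_of_nonneg_of_nonpos (inv_nonneg.2 (hposZ v hv).le) (hside v hv))
      (unit v) (memΩ.2 ⟨v, hv, rfl⟩)
    rw [hcross v hv] at this
    exact (mul_eq_zero.1 this).resolve_left (inv_ne_zero (hposZ v hv).ne'))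
  have hsmul : ∀ v, toPlane (c v • v) = (c v : ℝ) • toPlane v := fun v => by simp [toPlane]
  have hang : ∀ v ∈ Z, ang (toPlane (c v • v)) = ang (toPlane v) := by
    intro v hv
    have h0 := toPlane_ne_zero (hZ0 v hv)
    have hcv : (0 : ℝ) < c v := by exact_mod_cast hc v hv
    rw [hsmul, ang_eq_iff (smul_ne_zero hcv.ne' h0) h0, ray_eq_iff]
    exact SameRay.sameRay_pos_smul_left _ hcv
  -- `Z` has one vector per ray, so no two vectors merge into one edge.
  have hangZ : Set.InjOn (fun v => ang (toPlane v)) Z := by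
    intro v hv v' hv' h
    obtain ⟨ρ, hρ, rfl⟩ := memZ.1 hv
    obtain ⟨ρ', hρ', rfl⟩ := memZ.1 hv'
    obtain ⟨h1, h2⟩ := hz ρ hρ
    obtain ⟨h1', h2'⟩ := hz ρ' hρ'
    rw [← h2, ← h2', (ang_eq_iff h1 h1').1 h]
  have hinjc : Set.InjOn (fun v => c v • v) Z := by
    intro v hv v' hv' h
    refine hangZ hv hv' ?_
    simp only at h ⊢
    rw [← hang v hv, ← hang v' hv', h]
  set W : Finset (ℤ × ℤ) := Z.image fun v => c v • v with hW
  have memW : ∀ {w}, w ∈ W ↔ ∃ v ∈ Z, c v • v = w := by intro w; simp [hW]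
  have hsum : ∑ w ∈ W, w = 0 := by
    rw [hW, Finset.sum_image hinjc]; exact hrel
  have hW0 : ∀ w ∈ W, w ≠ 0 := by
    intro w hw
    obtain ⟨v, hv, rfl⟩ := memW.1 hw
    exact smul_ne_zero (hc v hv).ne' (hZ0 v hv)
  have hWne : W.Nonempty := hZne.image _
  have hWinj : Set.InjOn (fun w => ang (toPlane w)) W := by
    intro w hw w' hw' h
    obtain ⟨v, hv, rfl⟩ := memW.1 hw
    obtain ⟨v', hv', rfl⟩ := memW.1 hw'
    simp only [hang v hv, hang v' hv'] at h
    rw [hangZ hv hv' h]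
  set V := polygonVertices W with hV
  -- the recoding
  have hcode : ∀ᶠ n : ℕ in atTop, ∀ e ∈ V, ∀ x ∈ X.carrier, ∀ x' ∈ X.carrier,
      (∀ p ∈ truncatedDisc Ω n, ∀ u ∈ {u | ∃ v ∈ V, v ≠ e ∧ e - v = u},
        p + u ∈ truncatedDisc Ω n → x p = x' p) → ∀ p ∈ truncatedDisc Ω n, x p = x' p := by
    rw [Finset.eventually_all]
    intro e he
    -- Take an endpoint other than `e` of the edge `w`: the polygon, hence `e`, lies to the left of
    -- that edge.
    have hE : ∀ w ∈ W, ∃ v ∈ V, v ≠ e ∧ 0 ≤ cross (toPlane w) (toPlane (e - v)) := by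
      intro w hw
      obtain ⟨a, ha, b, hb, ⟨-, -, hab, hleft⟩, hsub⟩ := exists_orientedEdge hsum hW0 hWinj hw
      have h1 := hleft _ (toPlane_mem_polygonOf he)
      rw [hsub] at h1
      by_cases hae : a = e
      · refine ⟨b, hb, fun hbe => hab (by rw [hae, hbe]), ?_⟩
        have : toPlane (e - b) = -toPlane w := by rw [toPlane_sub, ← hsub, hae]; abel
        rw [this]
        simp only [cross, Prod.fst_neg, Prod.snd_neg]
        apply le_of_eq; ring
      · exact ⟨a, ha, hae, by rwa [toPlane_sub]⟩
    refine eventually_truncatedDisc_codes hΩne hunit hexp hclos ?_ ?_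
    · obtain ⟨w, hw⟩ := hWne
      obtain ⟨v, hv, hve, -⟩ := hE w hw
      exact ⟨e - v, v, hv, hve, rfl⟩
    · intro ω hω
      obtain ⟨y, hy, rfl⟩ := memΩ.1 hω
      obtain ⟨v, hv, hve, hcr⟩ := hE _ (memW.2 ⟨y, hy, rfl⟩)
      refine ⟨e - v, ⟨v, hv, hve, rfl⟩, sub_ne_zero.2 (Ne.symm hve), ?_⟩
      rw [hsmul, cross_smul_left] at hcr
      rw [hcross y hy]
      have hcy : (0 : ℝ) < c y := by exact_mod_cast hc y hy
      exact mul_nonneg (inv_nonneg.2 (hposZ y hy).le) (nonneg_of_mul_nonneg_right hcr hcy)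
  obtain ⟨n, hcode, hn⟩ := (hcode.and (eventually_ge_atTop 1)).exists
  set F : Finset (ℤ × ℤ) := (truncatedDisc_finite Ω (n : ℝ)).toFinset with hF
  have memF : ∀ {p}, p ∈ F ↔ p ∈ truncatedDisc Ω (n : ℝ) := by intro p; simp [hF]
  have hFne : F.Nonempty := ⟨0, memF.2 (zero_mem_truncatedDisc Ω (by exact_mod_cast hn))⟩
  have hrec := isRecoding_blockShift F X hFne
  have hinf : (blockShift F X).carrier.Infinite := by
    obtain ⟨ω, hω⟩ := hΩne
    exact (infinite_of_not_codes (hΩ0 ω hω) (hnon ω hω)).image (blockMap_injective F hFne).injOn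
  refine ⟨F → A, inferInstance, inferInstance, inferInstance, blockShift F X, polygonOf W, hrec,
    ⟨hinf, ⟨?_, V, rfl⟩, ?_⟩, ?_, ?_⟩
  · obtain ⟨w, hw⟩ := hWne
    obtain ⟨a, ha, b, hb, ⟨-, -, hab, -⟩, -⟩ := exists_orientedEdge hsum hW0 hWinj hw
    exact ⟨_, toPlane_mem_polygonOf ha, _, toPlane_mem_polygonOf hb, hab⟩
  · intro e he
    obtain ⟨e, heV, rfl⟩ := extremePoints_convexHull_subset he
    rintro _ ⟨x, hx, rfl⟩ _ ⟨x', hx', rfl⟩ hag p hp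
    obtain rfl : p = e := toPlane_injective hp
    funext f
    have := hcode p heV _ (X.mapsTo p hx) _ (X.mapsTo p hx') ?_ f.1 (memF.1 f.2)
    · simpa [blockMap, add_comm] using this
    -- The position `p + q` is also `v + (q + (p - v))`, hence visible in the pattern at `v`.
    · rintro q - _ ⟨v, hv, hve, rfl⟩ hq
      have := congrFun (hag v ⟨toPlane_mem_polygonOf hv, fun h => hve (toPlane_injective h)⟩)
        ⟨q + (p - v), memF.2 hq⟩
      simp only [blockMap] at this
      simp only [shift_apply]
      convert this using 2 <;> abel
  · intro a b hab
    obtain ⟨w, hw, hwang⟩ := exists_ang_eq_of_isOrientedEdge hsum hW0 hWne hab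
    obtain ⟨v, hv, rfl⟩ := memW.1 hw
    rw [hang v hv] at hwang
    obtain ⟨ρ, hρ, rfl⟩ := memZ.1 hv
    obtain ⟨hz0, hray⟩ := hz ρ hρ
    have hd : b - a ≠ 0 := sub_ne_zero.2 hab.2.2.1.symm
    exact ⟨ρ, hρ, hd, by rw [← hray, (ang_eq_iff hd hz0).1 hwang.symm]⟩
  · intro ρ hρ
    have hv : z ρ ∈ Z := memZ.2 ⟨ρ, hρ, rfl⟩
    obtain ⟨hz0, hray⟩ := hz ρ hρ
    obtain ⟨a, -, b, -, hab, hsub⟩ := exists_orientedEdge hsum hW0 hWinj (memW.2 ⟨_, hv, rfl⟩)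
    have hd : toPlane b - toPlane a ≠ 0 := sub_ne_zero.2 hab.2.2.1.symm
    refine ⟨_, _, hab, hd, ?_⟩
    rw [← hray, ← ang_eq_iff hd hz0, hsub, hang _ hv]
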